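/- Let $\mathbb K$ be a field, $n\ge 2$, $\mathbf a=(a_1,\dots,a_n)$ with all $a_i\ge 2$, and $\mathbf q=(q_{ij})$ an $n\times n$ matrix over $\mathbb K$ with $q_{ii}=1$ and $q_{ij}q_{ji}=1$. Let $A=A(\mathbf q,\mathbf a)=\mathbb K\langle x_1,\dots,x_n\rangle/\langle x_i^{a_i},\ x_jx_i-q_{ij}x_ix_j\rangle$, let $V=\{\mathbf v\in\mathbb N_0^n: v_i\le a_i-1\}$, $x_{\mathbf v}=x_1^{v_1}\cdots x_n^{v_n}$, let $\{x_{\mathbf v}\}_{\mathbf v\in V}$ be the standard basis of $A$ and $\{x_{\mathbf v}^*\}$ its dual basis, and write $\mathbf a-\mathbf 1=(a_1-1,\dots,a_n-1)$. $A$ is graded by $\deg x_{\mathbf v}=\sum_i v_i$. For $a,b,x\in A$, $f\in A^*$ put $(a\rightharpoonup f\leftharpoonup b)(x)=f(bxa)$. If $A$ also carries a coalgebra structure $(\Delta,\varepsilon)$ with $\Delta(c)=\sum c_1\otimes c_2$, put $f\rightharpoonup c=\sum c_1f(c_2)$ and $c\leftharpoonup f=\sum f(c_1)c_2$. A linear form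 $\phi\in A^*$ is a Frobenius homomorphism if $A^*=A\rightharpoonup\phi$; then $\mathcal N_\phi$ is the unique algebra automorphism of $A$ with $\phi(xy)=\phi(y\,\mathcal N_\phi(x))$ for all $x,y$ (the Nakayama automorphism). The form $x_{\mathbf a-\mathbf 1}^*$ is a Frobenius homomorphism, and $\mathcal N:=\mathcal N_{x_{\mathbf a-\mathbf 1}^*}$ is the canonical Nakayama automorphism. For $\mathbf u,\mathbf v\in\mathbb Z^n$ put $\mathbf q^{\langle\mathbf u|\mathbf v\rangle}=\prod_{i<j}q_{ij}^{u_jv_i}$ and $h_{\mathbf v}=\mathbf q^{\langle\mathbf a-\mathbf 1-\mathbf v|\mathbf v\rangle}/\mathbf q^{\langle\mathbf v|\mathbf a-\mathbf 1-\mathbf v\rangle}$; let $\mathbf e_i$ be the $i$-th unit vector. Let $(A,\phi,t,S)$ be a bi-Frobenius algebra structure on the algebra $A$; that is, a coalgebra structure $(\Delta,\varepsilon)$ on $A$, $\phi\in A^*$ and $t\in A$, such that $\varepsilon$ is an algebra homomorphism and $\Delta(1)=1\otimes 1$; $\phi$ is a Frobenius homomorphism and $A=t\leftharpoonup A^*$;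 and the map $S(a)=\sum\phi(t_1a)t_2$ is an algebra anti-homomorphism and a coalgebra anti-homomorphism. Let $\alpha=t\rightharpoonup\phi\in A^*$ be the right modular function and $\mathfrak a=\phi\rightharpoonup t\in A$ the right modular element. A right (left) integral of $A$ is $s\in A$ with $sx=\varepsilon(x)s$ (resp. $xs=\varepsilon(x)s$) for all $x\in A$, and $A$ is unimodular if the spaces of right and left integrals coincide. Then: (i) $\phi=x_{\mathbf a-\mathbf 1}^*\leftharpoonup z$ for some invertible $z\in A$; and $\phi=\sum_{\mathbf v\in V}c_{\mathbf v}x_{\mathbf v}^*$ with $c_{\mathbf v}\in\mathbb K$ and $c_{\mathbf a-\mathbf 1}\ne 0$. (ii) $\alpha=\varepsilon$, and $\varepsilon(x_{\mathbf v})=\delta_{\mathbf v,\mathbf 0}$ for $\mathbf v\in V$. (iii) $t=c\,x_{\mathbf a-\mathbf 1}$ with $c\in\mathbb K\setminus\{0\}$; and $A$ is unimodular with space of right integrals $\mathbb K x_{\mathbf a-\mathbf 1}$. (iv) $\mathcal N^2=\mathrm{Id}$, and $h_{\mathbf e_i}^2=1$ for $1\le i\le n$; moreover $\mathcal N(x_{\mathbf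 v})=h_{\mathbf v}x_{\mathbf v}$ for all $\mathbf v\in V$. (v) If $S$ is a graded map (it preserves each homogeneous component of $A$), then $S^2=\mathcal N$ and $S^4=\mathrm{Id}$. (vi) If $\operatorname{char}\mathbb K=0$, then $\mathfrak a=1$, $\mathcal N_\phi^2=\mathrm{Id}$ and $S^4=\mathrm{Id}$. -/

import Mathlib

open scoped TensorProduct

noncomputable section

/-! ### Frobenius algebras, Frobenius coalgebras and bi-Frobenius algebras -/

namespace BiFrob

section Algebra

variable {K A : Type*} [Field K] [Ring A] [Algebra K A]

/-- The left action `a ⇀ f` of `A` on `A^*`: `(a ⇀ f)(x) = f (x a)`. -/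
def leftAct (a : A) (f : Module.Dual K A) : Module.Dual K A :=
  f ∘ₗ LinearMap.mulRight K a

/-- The right action `f ↼ b` of `A` on `A^*`: `(f ↼ b)(x) = f (b x)`. -/
def rightAct (f : Module.Dual K A) (b : A) : Module.Dual K A :=
  f ∘ₗ LinearMap.mulLeft K b

/-- `φ` is a Frobenius homomorphism of `A`: `A^* = A ⇀ φ`. -/
def IsFrobenius (φ : Module.Dual K A) : Prop :=
  ∀ f : Module.Dual K A, ∃ a : A, f = leftAct a φ

/-- The map `A → A^*`, `a ↦ a ⇀ φ`. -/
def toDual (φ : Module.Dual K A) : A →ₗ[K] Module.Dual K A where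
  toFun a := leftAct a φ
  map_add' a b := by ext x; simp [leftAct, mul_add]
  map_smul' c a := by ext x; simp [leftAct]

@[simp] theorem toDual_apply (φ : Module.Dual K A) (a x : A) : toDual φ a x = φ (x * a) := rfl

/-- For a finite-dimensional Frobenius algebra, `a ↦ a ⇀ φ` is an isomorphism `A ≅ A^*`. -/
def IsFrobenius.dualEquiv [FiniteDimensional K A] {φ : Module.Dual K A} (h : IsFrobenius φ) :
    A ≃ₗ[K] Module.Dual K A :=
  LinearEquiv.ofBijective (toDual φ) (by
    have hs : Function.Surjective (toDual φ) := fun f => by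
      obtain ⟨a, ha⟩ := h f
      exact ⟨a, ha.symm⟩
    exact ⟨(LinearMap.injective_iff_surjective_of_finrank_eq_finrank
      (Subspace.dual_finrank_eq (K := K) (V := A)).symm).2 hs, hs⟩)

theorem IsFrobenius.dualEquiv_apply [FiniteDimensional K A] {φ : Module.Dual K A}
    (h : IsFrobenius φ) (a x : A) : h.dualEquiv a x = φ (x * a) := rfl

/-- The map `A → A^*`, `x ↦ φ ↼ x`. -/
def toDualRight (φ : Module.Dual K A) : A →ₗ[K] Module.Dual K A where
  toFun x := rightAct φ x
  map_add' x y := by ext z; simp [rightAct, add_mul]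
  map_smul' c x := by ext z; simp [rightAct]

/-- The linear map underlying the Nakayama automorphism. -/
def IsFrobenius.nakayamaLin [FiniteDimensional K A] {φ : Module.Dual K A} (h : IsFrobenius φ) :
    A →ₗ[K] A :=
  h.dualEquiv.symm.toLinearMap ∘ₗ toDualRight φ

theorem IsFrobenius.nakayamaLin_spec [FiniteDimensional K A] {φ : Module.Dual K A}
    (h : IsFrobenius φ) (x y : A) : φ (x * y) = φ (y * h.nakayamaLin x) := by
  have e : h.dualEquiv (h.nakayamaLin x) = toDualRight φ x := h.dualEquiv.apply_symm_apply _
  exact (LinearMap.congr_fun e y).symm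

theorem IsFrobenius.ext_right [FiniteDimensional K A] {φ : Module.Dual K A}
    (h : IsFrobenius φ) {u v : A} (huv : ∀ y, φ (y * u) = φ (y * v)) : u = v :=
  h.dualEquiv.injective (by ext y; simpa [h.dualEquiv_apply] using huv y)

theorem IsFrobenius.ext_left {φ : Module.Dual K A}
    (h : IsFrobenius φ) {u v : A} (huv : ∀ y, φ (u * y) = φ (v * y)) : u = v := by
  rw [← sub_eq_zero, ← Module.forall_dual_apply_eq_zero_iff K]
  intro f
  obtain ⟨a, rfl⟩ := h f
  have := huv a
  simpa [leftAct, sub_mul, sub_eq_zero] using this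

/-- The Nakayama automorphism `N_φ` of a finite-dimensional Frobenius algebra `(A, φ)`: the unique
algebra automorphism with `φ (x y) = φ (y N_φ(x))`. -/
def IsFrobenius.nakayama [FiniteDimensional K A] {φ : Module.Dual K A} (h : IsFrobenius φ) :
    A ≃ₐ[K] A :=
  AlgEquiv.ofBijective
    (AlgHom.ofLinearMap h.nakayamaLin
      (h.ext_right fun y => by rw [← h.nakayamaLin_spec]; simp)
      (fun x x' => h.ext_right fun y => by
        rw [← h.nakayamaLin_spec, mul_assoc, h.nakayamaLin_spec, mul_assoc,
          h.nakayamaLin_spec, mul_assoc]))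
    (by
      have hi : Function.Injective h.nakayamaLin := fun u v huv =>
        h.ext_left fun y => by rw [h.nakayamaLin_spec, h.nakayamaLin_spec v, huv]
      exact ⟨hi, LinearMap.injective_iff_surjective.1 hi⟩)

/-- The defining property of the Nakayama automorphism. -/
theorem IsFrobenius.nakayama_spec [FiniteDimensional K A] {φ : Module.Dual K A}
    (h : IsFrobenius φ) (x y : A) : φ (x * y) = φ (y * h.nakayama x) :=
  h.nakayamaLin_spec x y

/-- The space of right integrals `{t | t x = ε(x) t}` with respect to `ε : A → K`. -/
def rightIntegrals (ε : A →ₗ[K] K) : Submodule K A where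
  carrier := {t | ∀ x, t * x = ε x • t}
  add_mem' {s t} hs ht x := by rw [add_mul, hs x, ht x, smul_add]
  zero_mem' x := by simp
  smul_mem' c t ht x := by rw [smul_mul_assoc, ht x, smul_comm]

/-- The space of left integrals `{t | x t = ε(x) t}` with respect to `ε : A → K`. -/
def leftIntegrals (ε : A →ₗ[K] K) : Submodule K A where
  carrier := {t | ∀ x, x * t = ε x • t}
  add_mem' {s t} hs ht x := by rw [mul_add, hs x, ht x, smul_add]
  zero_mem' x := by simp
  smul_mem' c t ht x := by rw [mul_smul_comm, ht x, smul_comm]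

/-- `A` is unimodular (with respect to `ε`): left and right integrals coincide. -/
def IsUnimodular (ε : A →ₗ[K] K) : Prop := rightIntegrals ε = leftIntegrals ε

end Algebra

section Coalgebra

variable {K C : Type*} [Field K] [AddCommGroup C] [Module K C] [Coalgebra K C]

/-- The left action of `C^*` on `C`: `f ⇀ c = ∑ c₁ f(c₂)`. -/
def coLeftAct (f : Module.Dual K C) (c : C) : C :=
  TensorProduct.rid K C (f.lTensor C (Coalgebra.comul c))

/-- The right action of `C^*` on `C`: `c ↼ f = ∑ f(c₁) c₂`. -/
def coRightAct (c : C) (f : Module.Dual K C) : C :=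
  TensorProduct.lid K C (f.rTensor C (Coalgebra.comul c))

/-- `(C, t)` is a Frobenius coalgebra: `C = t ↼ C^*`. -/
def IsFrobeniusCoalgebra (t : C) : Prop :=
  ∀ c : C, ∃ f : Module.Dual K C, c = coRightAct t f

end Coalgebra

section BiFrobenius

variable {K A : Type*} [Field K] [Ring A] [Algebra K A] [Coalgebra K A]

/-- `(A, φ, t, S)` is a bi-Frobenius algebra. The algebra and coalgebra structures
on `A` are not assumed to be compatible beyond what is listed. -/
structure IsBiFrobenius (φ : Module.Dual K A) (t : A) (S : A →ₗ[K] A) : Prop where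
  finiteDimensional : FiniteDimensional K A
  /-- `S(a) = ∑ φ(t₁ a) t₂` -/
  antipode_eq : ∀ a, S a = coRightAct t (leftAct a φ)
  counit_one : Coalgebra.counit (R := K) (1 : A) = 1
  counit_mul : ∀ a b : A,
    Coalgebra.counit (R := K) (a * b) = Coalgebra.counit (R := K) a * Coalgebra.counit (R := K) b
  comul_one : Coalgebra.comul (R := K) (1 : A) = 1 ⊗ₜ[K] 1
  frobenius : IsFrobenius φ
  coFrobenius : IsFrobeniusCoalgebra (K := K) t
  antipode_one : S 1 = 1
  antipode_mul : ∀ a b, S (a * b) = S b * S a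
  counit_antipode : ∀ a, Coalgebra.counit (R := K) (S a) = Coalgebra.counit (R := K) a
  /-- `Δ(S(a)) = ∑ S(a₂) ⊗ S(a₁)` -/
  comul_antipode : ∀ a, Coalgebra.comul (R := K) (S a) =
    TensorProduct.map S S (TensorProduct.comm K A A (Coalgebra.comul (R := K) a))

/-- The right modular function `α = t ⇀ φ`. -/
def modularFunction (φ : Module.Dual K A) (t : A) : Module.Dual K A := leftAct t φ

/-- The right modular element `𝔞 = φ ⇀ t`. -/
def modularElement (φ : Module.Dual K A) (t : A) : A := coLeftAct φ t

end BiFrobenius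

end BiFrob

/-! ### Quantum complete intersections -/

/-- The parameters of a quantum complete intersection in `n` variables. -/
structure QCIData (K : Type*) [Field K] (n : ℕ) where
  a : Fin n → ℕ
  q : Matrix (Fin n) (Fin n) K
  two_le_n : 2 ≤ n
  two_le_a : ∀ i, 2 ≤ a i
  q_diag : ∀ i, q i i = 1
  q_mul : ∀ i j, q i j * q j i = 1

namespace QCIData

variable {K : Type*} [Field K] {n : ℕ} (D : QCIData K n)

/-- The defining relations `x_i ^ a_i = 0` and `x_j x_i = q_ij x_i x_j`. -/
inductive Rel : FreeAlgebra K (Fin n) → FreeAlgebra K (Fin n) → Prop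
  | pow (i : Fin n) : Rel (FreeAlgebra.ι K i ^ D.a i) 0
  | comm (i j : Fin n) : Rel (FreeAlgebra.ι K j * FreeAlgebra.ι K i)
      (D.q i j • (FreeAlgebra.ι K i * FreeAlgebra.ι K j))

/-- The quantum complete intersection `A(q, a)`: the quotient of the free algebra by the two-sided
ideal generated by the relations. -/
def Alg : Type _ := RingQuot D.Rel

instance : Ring D.Alg := inferInstanceAs (Ring (RingQuot D.Rel))

instance : Algebra K D.Alg := inferInstanceAs (Algebra K (RingQuot D.Rel))

/-- The quotient map from the free algebra. -/
def proj : FreeAlgebra K (Fin n) →ₐ[K] D.Alg := RingQuot.mkAlgHom K D.Rel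

/-- The generators `x_i`. -/
def x (i : Fin n) : D.Alg := D.proj (FreeAlgebra.ι K i)

/-- The monomial `x_v = x_1 ^ v_1 ⋯ x_n ^ v_n`. -/
def mono (v : Fin n → ℕ) : D.Alg := ((List.finRange n).map fun i => D.x i ^ v i).prod

/-- The index set `V = {v | 0 ≤ v_i ≤ a_i - 1}`. -/
abbrev V : Type := ∀ i, Fin (D.a i)

/-- The inclusion of `V` in `ℕ^n`. -/
def exps (v : D.V) : Fin n → ℕ := fun i => (v i : ℕ)

/-- The vector `a - 1`, the largest element of `V`. -/
def top : D.V := fun i => ⟨D.a i - 1, by have := D.two_le_a i; omega⟩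

/-- `q^⟨u|v⟩ = ∏_{i<j} q_ij ^ (u_j v_i)` for integer vectors. -/
def qbr (u v : Fin n → ℤ) : K :=
  ∏ i, ∏ j, if i < j then D.q i j ^ (u j * v i) else 1

/-- The integer vector `a - 1`. -/
def aSubOne : Fin n → ℤ := fun i => (D.a i : ℤ) - 1

/-- `h_v = q^⟨a-1-v|v⟩ / q^⟨v|a-1-v⟩`. -/
def h (v : Fin n → ℤ) : K := D.qbr (D.aSubOne - v) v / D.qbr v (D.aSubOne - v)

/-! #### The standard basis -/

theorem x_pow (i : Fin n) : D.x i ^ D.a i = 0 := by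
  rw [x, ← map_pow]
  exact (RingQuot.mkAlgHom_rel K (Rel.pow (D := D) i)).trans (map_zero _)

theorem x_comm (i j : Fin n) : D.x j * D.x i = D.q i j • (D.x i * D.x j) := by
  rw [x, x, ← map_mul, ← map_mul, ← map_smul]
  exact RingQuot.mkAlgHom_rel K (Rel.comm (D := D) i j)

theorem q_ne_zero (i j : Fin n) : D.q i j ≠ 0 := left_ne_zero_of_mul_eq_one (D.q_mul i j)

theorem x_mul_pow (i j : Fin n) (m : ℕ) :
    D.x i * D.x j ^ m = D.q j i ^ m • (D.x j ^ m * D.x i) := by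
  induction m with
  | zero => simp
  | succ m ih =>
    rw [pow_succ, ← mul_assoc, ih, smul_mul_assoc, mul_assoc, D.x_comm j i, mul_smul_comm,
      smul_smul, pow_succ, mul_assoc]

theorem x_mul_list (i : Fin n) (v : Fin n → ℕ) (l : List (Fin n)) (hl : l.Nodup) (hi : i ∈ l) :
    ∃ c : K, c ≠ 0 ∧ D.x i * (l.map fun j => D.x j ^ v j).prod =
      c • (l.map fun j => D.x j ^ (v + Pi.single i 1 : Fin n → ℕ) j).prod := by
  induction l with
  | nil => simp at hi
  | cons j l ih =>
    rw [List.nodup_cons] at hl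
    by_cases hij : i = j
    · subst hij
      refine ⟨1, one_ne_zero, ?_⟩
      have : (l.map fun j => D.x j ^ (v + Pi.single i 1 : Fin n → ℕ) j) = l.map fun j => D.x j ^ v j := by
        refine List.map_congr_left fun k hk => ?_
        have : k ≠ i := fun e => hl.1 (e ▸ hk)
        simp [this]
      rw [List.map_cons, List.map_cons, this]
      simp [pow_succ', mul_assoc]
    · obtain ⟨c, hc, e⟩ := ih hl.2 ((List.mem_cons.1 hi).resolve_left hij)
      refine ⟨D.q j i ^ v j * c, mul_ne_zero (pow_ne_zero _ (D.q_ne_zero _ _)) hc, ?_⟩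
      rw [List.map_cons, List.map_cons, List.prod_cons, List.prod_cons, ← mul_assoc, D.x_mul_pow,
        smul_mul_assoc, mul_assoc, e, mul_smul_comm, smul_smul]
      simp [Ne.symm hij]

theorem x_mul_mono (i : Fin n) (v : Fin n → ℕ) :
    ∃ c : K, c ≠ 0 ∧ D.x i * D.mono v = c • D.mono (v + Pi.single i 1) :=
  D.x_mul_list i v _ (List.nodup_finRange n) (List.mem_finRange i)

theorem x_pow_mul_mono (i : Fin n) (m : ℕ) (v : Fin n → ℕ) :
    ∃ c : K, c ≠ 0 ∧ D.x i ^ m * D.mono v = c • D.mono (v + Pi.single i m) := by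
  induction m with
  | zero => exact ⟨1, one_ne_zero, by simp⟩
  | succ m ih =>
    obtain ⟨c, hc, e⟩ := ih
    obtain ⟨d, hd, e'⟩ := D.x_mul_mono i (v + Pi.single i m)
    refine ⟨c * d, mul_ne_zero hc hd, ?_⟩
    rw [pow_succ', mul_assoc, e, mul_smul_comm, e', smul_smul, add_assoc, ← Pi.single_add]

theorem mono_mul_mono (u v : Fin n → ℕ) :
    ∃ c : K, c ≠ 0 ∧ D.mono u * D.mono v = c • D.mono (u + v) := by
  have key : ∀ l : List (Fin n), ∃ c : K, c ≠ 0 ∧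
      (l.map fun j => D.x j ^ u j).prod * D.mono v =
        c • D.mono (v + (l.map fun j => Pi.single j (u j)).sum) := by
    intro l
    induction l with
    | nil => exact ⟨1, one_ne_zero, by simp⟩
    | cons j l ih =>
      obtain ⟨c, hc, e⟩ := ih
      obtain ⟨d, hd, e'⟩ := D.x_pow_mul_mono j (u j) (v + (l.map fun j => Pi.single j (u j)).sum)
      refine ⟨c * d, mul_ne_zero hc hd, ?_⟩
      rw [List.map_cons, List.prod_cons, mul_assoc, e, mul_smul_comm, e', smul_smul,
        List.map_cons, List.sum_cons]
      congr 2
      abel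
  obtain ⟨c, hc, e⟩ := key (List.finRange n)
  refine ⟨c, hc, e.trans ?_⟩
  congr 2
  rw [add_comm]
  congr 1
  have : ((List.finRange n).map fun j => Pi.single j (u j)).sum
      = ∑ j, (Pi.single j (u j) : Fin n → ℕ) := by
    rw [← List.ofFn_eq_map, List.sum_ofFn]
  rw [this, Finset.univ_sum_single]

theorem mono_eq_zero (v : Fin n → ℕ) (i : Fin n) (hi : D.a i ≤ v i) : D.mono v = 0 := by
  refine List.prod_eq_zero (List.mem_map.2 ⟨i, List.mem_finRange i, ?_⟩)
  exact pow_eq_zero_of_le hi (D.x_pow i)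

theorem mono_zero : D.mono 0 = 1 := by simp [mono]

theorem span_mono : Submodule.span K (Set.range fun v : D.V => D.mono (D.exps v)) = ⊤ := by
  set M := Submodule.span K (Set.range fun v : D.V => D.mono (D.exps v)) with hM
  have hmono : ∀ v, D.mono v ∈ M := fun v => by
    by_cases hv : ∀ i, v i < D.a i
    · exact Submodule.subset_span ⟨fun i => ⟨v i, hv i⟩, rfl⟩
    · push Not at hv
      obtain ⟨i, hi⟩ := hv
      rw [D.mono_eq_zero v i hi]
      exact M.zero_mem
  have hx : ∀ i, ∀ y ∈ M, D.x i * y ∈ M := fun i y hy => by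
    induction hy using Submodule.span_induction with
    | mem y hy =>
      obtain ⟨v, rfl⟩ := hy
      obtain ⟨c, -, e⟩ := D.x_mul_mono i (D.exps v)
      simp only [e]
      exact M.smul_mem _ (hmono _)
    | zero => simp
    | add y z _ _ hy hz => rw [mul_add]; exact M.add_mem hy hz
    | smul c y _ hy => rw [mul_smul_comm]; exact M.smul_mem _ hy
  have hall : ∀ f : FreeAlgebra K (Fin n), ∀ y ∈ M, D.proj f * y ∈ M := fun f => by
    induction f using FreeAlgebra.induction with
    | grade0 r =>
      intro y hy
      rw [AlgHom.commutes, ← Algebra.smul_def]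
      exact M.smul_mem _ hy
    | grade1 i => exact hx i
    | mul f g hf hg => intro y hy; rw [map_mul, mul_assoc]; exact hf _ (hg _ hy)
    | add f g hf hg =>
      intro y hy
      rw [map_add, add_mul]
      exact M.add_mem (hf _ hy) (hg _ hy)
  rw [eq_top_iff]
  rintro z -
  obtain ⟨f, rfl⟩ := RingQuot.mkAlgHom_surjective K D.Rel z
  have := hall f 1 (D.mono_zero ▸ hmono 0)
  rw [mul_one] at this
  exact this

/-- The coefficient `∏_{k<i} q_ki ^ v_k`. -/
def coef (i : Fin n) (v : Fin n → ℕ) : K := ∏ k, if k < i then D.q k i ^ v k else 1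

theorem coef_add (i j : Fin n) (v : Fin n → ℕ) :
    D.coef i (v + Pi.single j 1) = D.coef i v * if j < i then D.q j i else 1 := by
  have : (if j < i then D.q j i else 1) = ∏ k, if k = j then (if j < i then D.q j i else 1) else 1 := by
    simp
  rw [this, coef, coef, ← Finset.prod_mul_distrib]
  refine Finset.prod_congr rfl fun k _ => ?_
  by_cases hk : k = j
  · subst hk
    by_cases h : k < i <;> simp [h, pow_succ]
  · simp [hk]

/-- The operator by which `x_i` acts on the space spanned by all exponent vectors. -/
def op (i : Fin n) : Module.End K ((Fin n → ℕ) →₀ K) :=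
  Finsupp.lsum K fun v => LinearMap.toSpanSingleton K _
    (if v i + 1 < D.a i then Finsupp.single (v + Pi.single i 1) (D.coef i v) else 0)

theorem op_single (i : Fin n) (v : Fin n → ℕ) (c : K) : D.op i (Finsupp.single v c) =
    if v i + 1 < D.a i then Finsupp.single (v + Pi.single i 1) (c * D.coef i v) else 0 := by
  simp [op]

theorem op_pow (i : Fin n) (m : ℕ) (v : Fin n → ℕ) (c : K) (hm : D.a i ≤ v i + m) (h0 : 0 < m) :
    (D.op i ^ m) (Finsupp.single v c) = 0 := by
  induction m generalizing v c with
  | zero => omega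
  | succ m ih =>
    rw [pow_succ, Module.End.mul_apply, op_single]
    split_ifs with h
    · exact ih _ _ (by simp; omega) (by omega)
    · simp

theorem op_comm (i j : Fin n) : D.op j * D.op i = D.q i j • (D.op i * D.op j) := by
  by_cases hij : i = j
  · subst hij; simp [D.q_diag]
  refine Finsupp.lhom_ext fun v c => ?_
  simp only [Module.End.mul_apply, LinearMap.smul_apply, op_single]
  have h1 : (v + Pi.single i 1 : Fin n → ℕ) j = v j := by simp [Ne.symm hij]
  have h2 : (v + Pi.single j 1 : Fin n → ℕ) i = v i := by simp [hij]
  split_ifs with hi hj hj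
  · rw [op_single, op_single, if_pos (by rwa [h1]), if_pos (by rwa [h2]), Finsupp.smul_single,
      add_right_comm, D.coef_add, D.coef_add, smul_eq_mul]
    congr 1
    rcases lt_or_gt_of_ne hij with h | h
    · rw [if_pos h, if_neg h.asymm]; ring
    · rw [if_neg h.asymm, if_pos h]
      linear_combination (-(c * D.coef i v * D.coef j v)) * D.q_mul i j
  · rw [op_single, if_neg (by rwa [h1])]; simp
  · rw [op_single, if_neg (by rwa [h2])]; simp
  · simp

/-- The representation of `A(q, a)` on the space spanned by exponent vectors. -/
def rep : D.Alg →ₐ[K] Module.End K ((Fin n → ℕ) →₀ K) :=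
  RingQuot.liftAlgHom K ⟨FreeAlgebra.lift K D.op, by
    intro f g hfg
    cases hfg with
    | pow i =>
      rw [map_pow, FreeAlgebra.lift_ι_apply, map_zero]
      refine Finsupp.lhom_ext fun v c => ?_
      exact D.op_pow i _ v c (by omega) (by have := D.two_le_a i; omega)
    | comm i j =>
      rw [map_mul, map_smul, map_mul, FreeAlgebra.lift_ι_apply, FreeAlgebra.lift_ι_apply]
      exact D.op_comm i j⟩

theorem rep_x (i : Fin n) : D.rep (D.x i) = D.op i :=
  (RingQuot.liftAlgHom_mkAlgHom_apply K _ _ _).trans (FreeAlgebra.lift_ι_apply _ _)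

theorem op_pow_single (i : Fin n) (m : ℕ) (v : Fin n → ℕ) (hv : ∀ k ≤ i, v k = 0)
    (hm : m < D.a i) :
    (D.op i ^ m) (Finsupp.single v 1) = Finsupp.single (v + Pi.single i m) 1 := by
  induction m with
  | zero => simp
  | succ m ih =>
    have hc : D.coef i (v + Pi.single i m) = 1 := by
      refine Finset.prod_eq_one fun k _ => ?_
      split_ifs with hk
      · simp [hv k hk.le, hk.ne]
      · rfl
    rw [pow_succ', Module.End.mul_apply, ih (by omega), op_single,
      if_pos (by simpa [hv i le_rfl] using hm), hc, add_assoc, ← Pi.single_add, mul_one]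

theorem rep_mono (v : D.V) :
    D.rep (D.mono (D.exps v)) (Finsupp.single 0 1) = Finsupp.single (D.exps v) 1 := by
  have key : ∀ l : List (Fin n), l.Pairwise (· < ·) →
      D.rep (l.map fun j => D.x j ^ D.exps v j).prod (Finsupp.single 0 1) =
        Finsupp.single ((l.map fun j => Pi.single j (D.exps v j)).sum) 1 := by
    intro l hl
    induction l with
    | nil => simp
    | cons j l ih =>
      rw [List.pairwise_cons] at hl
      rw [List.map_cons, List.prod_cons, map_mul, Module.End.mul_apply, ih hl.2, map_pow, rep_x,
        op_pow_single, List.map_cons, List.sum_cons, add_comm]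
      · intro k hk
        have hs : ∀ l' : List (Fin n), (∀ b ∈ l', k < b) →
            ((l'.map fun j => (Pi.single j (D.exps v j) : Fin n → ℕ)).sum) k = 0 := by
          intro l' hl'
          induction l' with
          | nil => simp
          | cons b l' ih' =>
            rw [List.map_cons, List.sum_cons, Pi.add_apply,
              ih' fun b hb => hl' b (List.mem_cons_of_mem _ hb),
              Pi.single_eq_of_ne (hl' b List.mem_cons_self).ne]
        exact hs l fun b hb => lt_of_le_of_lt hk (hl.1 b hb)
      · exact (v j).2
  have h := key (List.finRange n) (List.pairwise_lt_finRange n)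
  have hsum : ((List.finRange n).map fun j => Pi.single j (D.exps v j)).sum = D.exps v := by
    rw [← List.ofFn_eq_map, List.sum_ofFn, Finset.univ_sum_single]
  rw [hsum] at h
  exact h

theorem exps_injective : Function.Injective D.exps := fun _ _ huv =>
  funext fun i => Fin.ext (congrFun huv i)

theorem linearIndependent_mono : LinearIndependent K fun v : D.V => D.mono (D.exps v) := by
  let f : D.Alg →ₗ[K] ((Fin n → ℕ) →₀ K) :=
    (LinearMap.applyₗ (Finsupp.single 0 1)) ∘ₗ D.rep.toLinearMap
  refine LinearIndependent.of_comp f ?_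
  have : (f ∘ fun v : D.V => D.mono (D.exps v)) =
      (fun w : Fin n → ℕ => (Finsupp.single w 1 : (Fin n → ℕ) →₀ K)) ∘ D.exps :=
    funext fun v => D.rep_mono v
  rw [this]
  exact (Finsupp.linearIndependent_single_one K _).comp _ D.exps_injective

/-- The standard basis `{x_v | v ∈ V}` of `A(q, a)`. -/
def stdBasis : Module.Basis D.V K D.Alg :=
  Module.Basis.mk D.linearIndependent_mono (le_of_eq D.span_mono.symm)

theorem stdBasis_apply (v : D.V) : D.stdBasis v = D.mono (D.exps v) :=
  Module.Basis.mk_apply _ _ v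

instance : FiniteDimensional K D.Alg := Module.Basis.finiteDimensional_of_finite D.stdBasis

/-- The dual basis element `x_v^*` of `A^*`. -/
def dualMono (v : D.V) : Module.Dual K D.Alg := D.stdBasis.coord v

theorem dualMono_mono (v u : D.V) :
    D.dualMono v (D.mono (D.exps u)) = if u = v then 1 else 0 := by
  rw [← stdBasis_apply, dualMono, Module.Basis.coord_apply, Module.Basis.repr_self,
    Finsupp.single_apply]

/-- `x_{a-1}^*` is a Frobenius homomorphism. -/
theorem isFrobenius_dualMono_top : BiFrob.IsFrobenius (D.dualMono D.top) := by
  have hb : ∀ u : D.V, ∃ b : D.Alg, D.dualMono u = BiFrob.leftAct b (D.dualMono D.top) := by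
    intro u
    let u' : D.V := fun i => ⟨D.a i - 1 - u i, by have := D.two_le_a i; omega⟩
    obtain ⟨c, hc, e⟩ := D.mono_mul_mono (D.exps u) (D.exps u')
    have htop : D.exps u + D.exps u' = D.exps D.top := by
      funext i
      have := (u i).2
      simp only [exps, u', top, Pi.add_apply]
      omega
    refine ⟨c⁻¹ • D.mono (D.exps u'), D.stdBasis.ext fun w => ?_⟩
    rw [D.stdBasis_apply, dualMono_mono]
    simp only [BiFrob.leftAct, LinearMap.comp_apply, LinearMap.mulRight_apply, mul_smul_comm,
      map_smul]
    by_cases hw : w = u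
    · subst hw
      rw [e, htop, map_smul, dualMono_mono]
      simp [hc]
    · rw [if_neg hw]
      obtain ⟨d, -, e'⟩ := D.mono_mul_mono (D.exps w) (D.exps u')
      rw [e', map_smul]
      suffices D.dualMono D.top (D.mono (D.exps w + D.exps u')) = 0 by rw [this]; simp
      by_cases hv : ∀ i, (D.exps w + D.exps u') i < D.a i
      · have := D.dualMono_mono D.top (fun i => ⟨_, hv i⟩)
        refine this.trans (if_neg fun h => hw ?_)
        refine D.exps_injective ?_
        have h' : D.exps w + D.exps u' = D.exps D.top := by rw [← h]; rfl
        exact add_right_cancel (h'.trans htop.symm)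
      · push Not at hv
        obtain ⟨i, hi⟩ := hv
        rw [D.mono_eq_zero _ i hi, map_zero]
  intro f
  choose b hb using hb
  refine ⟨∑ u, f (D.stdBasis u) • b u, ?_⟩
  change f = BiFrob.toDual (D.dualMono D.top) _
  rw [map_sum]
  simp_rw [map_smul]
  have : ∀ u, BiFrob.toDual (D.dualMono D.top) (b u) = D.dualMono u := fun u => (hb u).symm
  simp_rw [this]
  exact (D.stdBasis.sum_dual_apply_smul_coord f).symm

/-- The canonical Nakayama automorphism: the one with respect to `x_{a-1}^*`. -/
def canonicalNakayama : D.Alg ≃ₐ[K] D.Alg := D.isFrobenius_dualMono_top.nakayama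

/-- The degree `d` component of `A(q, a)`, spanned by the `x_v`, `v ∈ V`, with `∑ v_i = d`. -/
def homogeneous (d : ℕ) : Submodule K D.Alg :=
  Submodule.span K {y | ∃ v : D.V, ∑ i, D.exps v i = d ∧ y = D.mono (D.exps v)}

/-- A linear endomorphism is graded if it preserves every homogeneous component. -/
def IsGradedMap (S : D.Alg →ₗ[K] D.Alg) : Prop :=
  ∀ d, ∀ y ∈ D.homogeneous d, S y ∈ D.homogeneous d

end QCIData

end

noncomputable section

namespace BiFrob

/-! Write `𝔞` for the modular element and N for the canonical Nakayama automorphism. In `A(q, a)`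
each x_i is nilpotent, so any augmentation kills it; left and right integrals are then both spanned
by the top monomial. Hence the right integral `t` is also a left integral, and the general theory
simplifies. For a two-sided `t`, `dual_antipode` yields φ(ab) = φ(S²(b)a) (`apply_mul`), so N_φ =
S⁻². It also yields 𝔞x = S⁴(x)𝔞 (`modularElement_mul`), with 𝔞⁻¹ = S(𝔞). Thus N_φ² = S⁻⁴ is inner.
As φ is a unit translate of x_{a-1}^*, N_φ is conjugate to N (`nakayama_mul_canonicalNakayama`).
Conjugation by a unit fixes x_i modulo degree at least two (`sub_mem_degreeGE_two`), whereas N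
scales x_i. Comparing both descriptions of N_φ² gives h_{e_i}² = 1 and N² = Id. If S is graded, N∘S²
fixes each x_i modulo degree two, hence exactly, and S² = N. In characteristic zero, x ↦ S(S(x)𝔞) is
a coalgebra map (`comul_comp`) sending each power of S(𝔞) to the next, so these powers are
group-like. A finite-dimensional coalgebra has finitely many group-likes, so S(𝔞) has finite order;
it is also unipotent, hence 1. Then S⁴ = Id. -/

theorem eq_of_dual_map_eq {K C : Type*} [Field K] [AddCommGroup C] [Module K C]
    [FiniteDimensional K C] {x y : C ⊗[K] C}
    (hxy : ∀ f g : Module.Dual K C, LinearMap.mul' K K (TensorProduct.map f g x) =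
      LinearMap.mul' K K (TensorProduct.map f g y)) : x = y := by
  let b := Module.finBasis K C
  refine (b.tensorProduct b).ext_elem fun ⟨i, j⟩ => ?_
  have key : ∀ z : C ⊗[K] C, (b.tensorProduct b).repr z (i, j) =
      LinearMap.mul' K K (TensorProduct.map (b.coord i) (b.coord j) z) := by
    intro z
    induction z using TensorProduct.induction_on with
    | zero => simp
    | tmul x y => simp [mul_comm]
    | add x y hx hy => simp only [map_add, Finsupp.add_apply, hx, hy]
  rw [key, key, hxy]

/-! ### Dual actions, convolution and Frobenius coalgebras -/

section Coalgebra

variable {K C : Type*} [Field K] [AddCommGroup C] [Module K C] [Coalgebra K C]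

/-- Both sides are ∑ f(c₁) g(c₂). -/
theorem dual_coRightAct (c : C) (f g : Module.Dual K C) :
    g (coRightAct c f) = f (coLeftAct g c) := by
  unfold coRightAct coLeftAct
  induction Coalgebra.comul (R := K) c using TensorProduct.induction_on with
  | zero => simp
  | tmul x y => simp [mul_comm]
  | add x y hx hy => simp only [map_add, hx, hy]

theorem coLeftAct_counit (c : C) : coLeftAct (Coalgebra.counit (R := K)) c = c := by
  simp [coLeftAct]

/-- The map `f ↦ c ↼ f`. -/
def coRightActHom (c : C) : Module.Dual K C →ₗ[K] C where
  toFun f := coRightAct c f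
  map_add' f g := by simp [coRightAct, LinearMap.rTensor_add]
  map_smul' r f := by simp [coRightAct, LinearMap.rTensor_smul]

theorem IsFrobeniusCoalgebra.coRightAct_injective [FiniteDimensional K C] {t : C}
    (ht : IsFrobeniusCoalgebra (K := K) t) {f g : Module.Dual K C}
    (hfg : coRightAct t f = coRightAct t g) : f = g := by
  have hs : Function.Surjective (coRightActHom (K := K) t) := fun c => by
    obtain ⟨f, hf⟩ := ht c
    exact ⟨f, hf.symm⟩
  exact (LinearMap.injective_iff_surjective_of_finrank_eq_finrank
    (Subspace.dual_finrank_eq (K := K) (V := C))).2 hs hfg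

/-- The convolution product `(f * g)(c) = ∑ f(c₁) g(c₂)`. -/
def conv (f g : Module.Dual K C) : Module.Dual K C :=
  LinearMap.mul' K K ∘ₗ TensorProduct.map f g ∘ₗ Coalgebra.comul

theorem conv_apply_coRightAct (f g : Module.Dual K C) (c : C) :
    g (coRightAct c f) = conv f g c := by
  simp only [conv, coRightAct, LinearMap.comp_apply]
  induction Coalgebra.comul (R := K) c using TensorProduct.induction_on with
  | zero => simp
  | tmul x y => simp
  | add x y hx hy => simp only [map_add, hx, hy]

theorem conv_apply_coLeftAct (f g : Module.Dual K C) (c : C) :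
    f (coLeftAct g c) = conv f g c := by
  rw [← dual_coRightAct, conv_apply_coRightAct]

theorem conv_assoc (f g k : Module.Dual K C) : conv (conv f g) k = conv f (conv g k) := by
  ext c
  have e := Coalgebra.coassoc_apply (R := K) c
  have e1 : ∀ x : C ⊗[K] C, LinearMap.mul' K K (TensorProduct.map (conv f g) k x) =
      LinearMap.mul' K K (TensorProduct.map f (LinearMap.mul' K K ∘ₗ TensorProduct.map g k)
        (TensorProduct.assoc K C C C (Coalgebra.comul.rTensor C x))) := by
    intro x
    induction x using TensorProduct.induction_on with
    | zero => simp
    | tmul x y =>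
      simp only [conv, TensorProduct.map_tmul, LinearMap.comp_apply, LinearMap.rTensor_tmul]
      induction Coalgebra.comul (R := K) x using TensorProduct.induction_on with
      | zero => simp
      | tmul x y => simp [mul_assoc]
      | add x y hx hy => simp only [map_add, TensorProduct.add_tmul, hx, hy]
    | add x y hx hy => simp only [map_add, hx, hy]
  have e2 : ∀ x : C ⊗[K] C, LinearMap.mul' K K (TensorProduct.map f (conv g k) x) =
      LinearMap.mul' K K (TensorProduct.map f (LinearMap.mul' K K ∘ₗ TensorProduct.map g k)
        (Coalgebra.comul.lTensor C x)) := by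
    intro x
    induction x using TensorProduct.induction_on with
    | zero => simp
    | tmul x y => simp [conv]
    | add x y hx hy => simp only [map_add, hx, hy]
  change LinearMap.mul' K K (TensorProduct.map (conv f g) k _) =
    LinearMap.mul' K K (TensorProduct.map f (conv g k) _)
  rw [e1, e2, e]

/-- A linear map that intertwines `t₁ f(t₂)` with `f(t₁) t₂` is comultiplicative. -/
theorem IsFrobeniusCoalgebra.conv_comp [FiniteDimensional K C] {t : C}
    (ht : IsFrobeniusCoalgebra (K := K) t) {M : C →ₗ[K] C}
    (hM : ∀ f : Module.Dual K C, coLeftAct f t = coRightAct t (f ∘ₗ M))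
    (f g : Module.Dual K C) : conv f g ∘ₗ M = conv (f ∘ₗ M) (g ∘ₗ M) := by
  have hM' : ∀ k f : Module.Dual K C, conv k f t = conv (f ∘ₗ M) k t := fun k f => by
    rw [← conv_apply_coLeftAct, hM, conv_apply_coRightAct]
  refine ht.coRightAct_injective ?_
  rw [← sub_eq_zero, ← Module.forall_dual_apply_eq_zero_iff K]
  intro k
  -- `hM'` is twisted cyclicity of evaluation at `t`: the last factor moves to the front at the cost
  -- of `M`. Moving `f * g` as one block, or `g` and then `f`, gives the two sides.
  rw [map_sub, sub_eq_zero, conv_apply_coRightAct, conv_apply_coRightAct, ← hM', ← conv_assoc,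
    hM', ← conv_assoc, hM', conv_assoc]

/-- Dual form of `conv_comp`: functionals f ⊗ g separate the points of C ⊗ C. -/
theorem IsFrobeniusCoalgebra.comul_comp [FiniteDimensional K C] {t : C}
    (ht : IsFrobeniusCoalgebra (K := K) t) {M : C →ₗ[K] C}
    (hM : ∀ f : Module.Dual K C, coLeftAct f t = coRightAct t (f ∘ₗ M)) (c : C) :
    Coalgebra.comul (R := K) (M c) = TensorProduct.map M M (Coalgebra.comul (R := K) c) := by
  refine eq_of_dual_map_eq fun f g => ?_
  have := LinearMap.congr_fun (ht.conv_comp hM f g) c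
  simp only [conv, LinearMap.comp_apply] at this
  rw [this, ← LinearMap.comp_apply (TensorProduct.map f g), ← TensorProduct.map_comp]

theorem IsFrobeniusCoalgebra.counit_comp [FiniteDimensional K C] {t : C}
    (ht : IsFrobeniusCoalgebra (K := K) t) {M : C →ₗ[K] C}
    (hM : ∀ f : Module.Dual K C, coLeftAct f t = coRightAct t (f ∘ₗ M)) :
    Coalgebra.counit (R := K) ∘ₗ M = Coalgebra.counit := by
  refine ht.coRightAct_injective ?_
  rw [← hM, coLeftAct_counit]
  simp [coRightAct]

end Coalgebra

/-! ### Integrals, antipode and modular element of a bi-Frobenius algebra -/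

section BiFrobenius

variable {K A : Type*} [Field K] [Ring A] [Algebra K A] [Coalgebra K A]
  {φ : Module.Dual K A} {t : A} {S : A →ₗ[K] A}

namespace IsBiFrobenius

/-- The counit as an algebra homomorphism. -/
def counitHom (hA : IsBiFrobenius φ t S) : A →ₐ[K] K :=
  AlgHom.ofLinearMap Coalgebra.counit hA.counit_one hA.counit_mul

theorem counitHom_apply (hA : IsBiFrobenius φ t S) (x : A) :
    hA.counitHom x = Coalgebra.counit (R := K) x := rfl

/-- The source of the identities linking S and φ: the choices of `g` used below are ε, φ and (a ⇀ φ)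
∘ S. -/
theorem dual_antipode (hA : IsBiFrobenius φ t S) (g : Module.Dual K A) (a : A) :
    g (S a) = φ (coLeftAct g t * a) := by
  rw [hA.antipode_eq, dual_coRightAct]
  rfl

theorem apply_integral_mul (hA : IsBiFrobenius φ t S) (a : A) :
    φ (t * a) = Coalgebra.counit (R := K) a := by
  rw [← hA.counit_antipode, hA.dual_antipode, coLeftAct_counit]

theorem apply_integral (hA : IsBiFrobenius φ t S) : φ t = 1 := by
  simpa [hA.counit_one] using hA.apply_integral_mul 1

/-- φ(txy) = ε(xy) = ε(x) φ(ty), and φ is nondegenerate. -/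
theorem mem_rightIntegrals (hA : IsBiFrobenius φ t S) :
    t ∈ rightIntegrals (Coalgebra.counit (R := K) (A := A)) := fun x =>
  hA.frobenius.ext_left fun y => by
    rw [mul_assoc, hA.apply_integral_mul, hA.counit_mul, smul_mul_assoc, map_smul,
      hA.apply_integral_mul, smul_eq_mul]

/-- S is the composite A → A^* → A of two maps, onto by the Frobenius conditions on φ and on `t`. -/
theorem antipode_surjective (hA : IsBiFrobenius φ t S) : Function.Surjective S := fun c => by
  obtain ⟨f, rfl⟩ := hA.coFrobenius c
  obtain ⟨a, rfl⟩ := hA.frobenius f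
  exact ⟨a, hA.antipode_eq a⟩

theorem antipode_injective (hA : IsBiFrobenius φ t S) : Function.Injective S :=
  have := hA.finiteDimensional
  LinearMap.injective_iff_surjective.2 hA.antipode_surjective

theorem coRightAct_antipode (hA : IsBiFrobenius φ t S) (c : A) (f : Module.Dual K A) :
    coRightAct (S c) f = S (coLeftAct (f ∘ₗ S) c) := by
  simp only [coRightAct, coLeftAct, hA.comul_antipode]
  induction Coalgebra.comul (R := K) c using TensorProduct.induction_on with
  | zero => simp
  | tmul x y => simp
  | add x y hx hy => simp only [map_add, hx, hy]

/-- The antipode as a linear equivalence. -/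
def antipodeEquiv (hA : IsBiFrobenius φ t S) : A ≃ₗ[K] A :=
  LinearEquiv.ofBijective S ⟨hA.antipode_injective, hA.antipode_surjective⟩

theorem apply_antipode (hA : IsBiFrobenius φ t S) (a : A) :
    φ (S a) = φ (modularElement φ t * a) := hA.dual_antipode φ a

theorem counit_modularElement (hA : IsBiFrobenius φ t S) :
    Coalgebra.counit (R := K) (modularElement φ t) = 1 := by
  rw [modularElement, ← dual_coRightAct, ← hA.apply_integral]
  simp [coRightAct]

/-- If the right integral `t` is also a left integral, then `S t` is a multiple of `t`. -/
theorem antipode_integral_eq_smul (hA : IsBiFrobenius φ t S)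
    (ht : t ∈ leftIntegrals (Coalgebra.counit (R := K) (A := A))) : S t = φ (S t) • t := by
  have := hA.finiteDimensional
  refine hA.frobenius.ext_right fun y => ?_
  -- Testing against S(x): φ(S(x)S(t)) = φ(S(tx)) = ε(x) φ(S(t)), while φ(S(x)t) = ε(S(x)) φ(t) =
  -- ε(x).
  obtain ⟨x, rfl⟩ := hA.antipode_surjective y
  rw [← hA.antipode_mul, hA.mem_rightIntegrals x, map_smul, map_smul, mul_smul_comm, ht,
    map_smul, map_smul, hA.apply_integral, hA.counit_antipode, smul_eq_mul, smul_eq_mul,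
    smul_eq_mul, mul_one, mul_comm]

/-- Applying S turns both sides into S(t) ↼ (a ⇀ φ): on the left because S(t) = φ(S(t)) t, on the
right because S reverses Δ. -/
theorem smul_eq_coLeftAct (hA : IsBiFrobenius φ t S)
    (ht : t ∈ leftIntegrals (Coalgebra.counit (R := K) (A := A))) (a : A) :
    φ (S t) • a = coLeftAct (leftAct a φ ∘ₗ S) t := by
  apply hA.antipode_injective
  have h : ∀ c : K, coRightAct (c • t) (leftAct a φ) = c • coRightAct t (leftAct a φ) := by
    simp [coRightAct]
  rw [map_smul, hA.antipode_eq a, ← h, ← hA.antipode_integral_eq_smul ht, hA.coRightAct_antipode]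

theorem apply_antipode_integral (hA : IsBiFrobenius φ t S)
    (ht : t ∈ leftIntegrals (Coalgebra.counit (R := K) (A := A))) : φ (S t) = 1 := by
  -- At 1 the left side is φ(t) = 1; by `smul_eq_coLeftAct` the right side is φ(S(t)) φ(t).
  have h := hA.dual_antipode (leftAct t φ ∘ₗ S) 1
  rw [← hA.smul_eq_coLeftAct ht] at h
  simpa [leftAct, hA.antipode_one, hA.apply_integral] using h.symm

theorem coLeftAct_comp_antipode (hA : IsBiFrobenius φ t S)
    (ht : t ∈ leftIntegrals (Coalgebra.counit (R := K) (A := A))) (a : A) :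
    coLeftAct (leftAct a φ ∘ₗ S) t = a := by
  rw [← hA.smul_eq_coLeftAct ht, hA.apply_antipode_integral ht, one_smul]

/-- `dual_antipode` for g = (a ⇀ φ) ∘ S, since g ⇀ t = a. -/
theorem apply_mul (hA : IsBiFrobenius φ t S)
    (ht : t ∈ leftIntegrals (Coalgebra.counit (R := K) (A := A))) (a b : A) :
    φ (a * b) = φ (S (S b) * a) := by
  have h := hA.dual_antipode (leftAct a φ ∘ₗ S) b
  rw [hA.coLeftAct_comp_antipode ht] at h
  exact h.symm

/-- The Nakayama automorphism of `φ` is the inverse of the square of the antipode. -/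
theorem nakayama_antipode_antipode [FiniteDimensional K A] (hA : IsBiFrobenius φ t S)
    (ht : t ∈ leftIntegrals (Coalgebra.counit (R := K) (A := A))) (b : A) :
    hA.frobenius.nakayama (S (S b)) = b :=
  hA.frobenius.ext_right fun y => by
    rw [← hA.frobenius.nakayama_spec, hA.apply_mul ht y b]

/-- The fourth power of the antipode is conjugation by the modular element. -/
theorem modularElement_mul (hA : IsBiFrobenius φ t S)
    (ht : t ∈ leftIntegrals (Coalgebra.counit (R := K) (A := A))) (x : A) :
    modularElement φ t * x = S (S (S (S x))) * modularElement φ t :=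
  hA.frobenius.ext_left fun y => by
    -- φ(𝔞xy) = φ(S(y)S(x)) = φ(S³(x)S(y)) = φ(S(y S²(x))) = φ(𝔞y S²(x)) = φ(S⁴(x)𝔞y).
    rw [mul_assoc, ← hA.apply_antipode, hA.antipode_mul, hA.apply_mul ht, ← hA.antipode_mul,
      hA.apply_antipode, ← mul_assoc, hA.apply_mul ht, mul_assoc]

theorem antipode_modularElement_mul (hA : IsBiFrobenius φ t S)
    (ht : t ∈ leftIntegrals (Coalgebra.counit (R := K) (A := A))) :
    S (modularElement φ t) * modularElement φ t = 1 :=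
  hA.frobenius.ext_left fun x => by
    obtain ⟨b, hb⟩ := hA.antipode_surjective (modularElement φ t)
    -- With 𝔞 = S(b): φ(S²(b)𝔞x) = φ(𝔞xb) = φ(S(xb)) = φ(𝔞S(x)) = φ(S²(x)) = φ(x).
    rw [one_mul, mul_assoc, ← hb, ← hA.apply_mul ht, mul_assoc, hb, ← hA.apply_antipode,
      hA.antipode_mul, hb, ← hA.apply_antipode, ← mul_one (S (S x)), ← hA.apply_mul ht, one_mul]

theorem modularElement_mul_antipode (hA : IsBiFrobenius φ t S)
    (ht : t ∈ leftIntegrals (Coalgebra.counit (R := K) (A := A))) :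
    modularElement φ t * S (modularElement φ t) = 1 := by
  have := hA.finiteDimensional
  have : IsNoetherianRing A := isNoetherian_of_tower K (inferInstance : IsNoetherian K A)
  exact mul_eq_one_comm.1 (hA.antipode_modularElement_mul ht)

theorem antipode_antipode_modularElement (hA : IsBiFrobenius φ t S)
    (ht : t ∈ leftIntegrals (Coalgebra.counit (R := K) (A := A))) :
    S (S (modularElement φ t)) = modularElement φ t := by
  have h := congrArg S (hA.antipode_modularElement_mul ht)
  rw [hA.antipode_mul, hA.antipode_one] at h
  have h' := congrArg (modularElement φ t * ·) h
  simpa only [← mul_assoc, hA.modularElement_mul_antipode ht, one_mul, mul_one] using h'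

/-- The map `x ↦ S(S(x) 𝔞)`. -/
def coNakayama (φ : Module.Dual K A) (t : A) (S : A →ₗ[K] A) : A →ₗ[K] A :=
  S ∘ₗ LinearMap.mulRight K (modularElement φ t) ∘ₗ S

/-- The coalgebra counterpart of a Nakayama automorphism. Every functional is f = (S(c) ⇀ φ) ∘ S,
for which f ⇀ t = S(c) = t ↼ (c ⇀ φ); it remains to identify f ∘ `coNakayama` with c ⇀ φ. -/
theorem coLeftAct_eq_coRightAct_coNakayama (hA : IsBiFrobenius φ t S)
    (ht : t ∈ leftIntegrals (Coalgebra.counit (R := K) (A := A))) (f : Module.Dual K A) :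
    coLeftAct f t = coRightAct t (f ∘ₗ coNakayama φ t S) := by
  obtain ⟨a, ha⟩ := hA.frobenius (f ∘ₗ hA.antipodeEquiv.symm.toLinearMap)
  obtain ⟨c, rfl⟩ := hA.antipode_surjective a
  have hf : f = leftAct (S c) φ ∘ₗ S := by
    ext x
    have := LinearMap.congr_fun ha (S x)
    simp only [LinearMap.comp_apply, LinearEquiv.coe_coe] at this
    rw [LinearMap.comp_apply, ← this]
    exact congrArg f (hA.antipodeEquiv.symm_apply_apply x).symm
  have h𝔞 := hA.antipode_antipode_modularElement ht
  have hM : f ∘ₗ coNakayama φ t S = leftAct c φ := by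
    ext x
    rw [hf]
    change φ (S (S (S x * modularElement φ t)) * S c) = φ (x * c)
    -- The left side becomes φ(S(xc)𝔞); writing 𝔞 = S²(𝔞) makes it φ(S(S(𝔞)xc)) = φ(𝔞S(𝔞)xc) =
    -- φ(xc).
    rw [← hA.apply_mul ht, ← mul_assoc, ← hA.antipode_mul]
    nth_rw 1 [← h𝔞]
    rw [← hA.antipode_mul, hA.apply_antipode, ← mul_assoc, hA.modularElement_mul_antipode ht,
      one_mul]
  rw [hM, ← hA.antipode_eq, hf, hA.coLeftAct_comp_antipode ht]

theorem coNakayama_pow (hA : IsBiFrobenius φ t S)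
    (ht : t ∈ leftIntegrals (Coalgebra.counit (R := K) (A := A))) (k : ℕ) :
    coNakayama φ t S (S (modularElement φ t) ^ k) = S (modularElement φ t) ^ (k + 1) := by
  have hb : ∀ k, S (S (S (modularElement φ t) ^ k)) = S (modularElement φ t) ^ k := by
    intro k
    induction k with
    | zero => simp [hA.antipode_one]
    | succ k ih =>
      rw [pow_succ, hA.antipode_mul, hA.antipode_mul, ih, hA.antipode_antipode_modularElement ht]
  change S (S _ * modularElement φ t) = _
  rw [hA.antipode_mul, hb, pow_succ']

/-- Δ need not be multiplicative, so powers of a group-like are not automatically group-like.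
Instead, the coalgebra map `coNakayama` carries each power to the next, starting from 1. -/
theorem isGroupLikeElem_antipode_modularElement_pow (hA : IsBiFrobenius φ t S)
    (ht : t ∈ leftIntegrals (Coalgebra.counit (R := K) (A := A))) (k : ℕ) :
    IsGroupLikeElem K (S (modularElement φ t) ^ k) := by
  have := hA.finiteDimensional
  have hM := hA.coLeftAct_eq_coRightAct_coNakayama ht
  induction k with
  | zero => exact ⟨by simpa using hA.counit_one, by simpa using hA.comul_one⟩
  | succ k ih =>
    rw [← hA.coNakayama_pow ht]
    refine ⟨?_, ?_⟩
    · rw [← ih.counit_eq_one]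
      exact LinearMap.congr_fun (hA.coFrobenius.counit_comp hM) _
    · rw [hA.coFrobenius.comul_comp hM, ih.comul_eq_tmul_self, TensorProduct.map_tmul]

/-- In characteristic zero a unipotent modular element is trivial. -/
theorem modularElement_eq_one [CharZero K] (hA : IsBiFrobenius φ t S)
    (ht : t ∈ leftIntegrals (Coalgebra.counit (R := K) (A := A)))
    (hn : IsNilpotent (S (modularElement φ t) - 1)) : modularElement φ t = 1 := by
  have := hA.finiteDimensional
  set b := S (modularElement φ t) with hb
  -- Distinct group-likes are linearly independent.
  have hfin : {a : A | IsGroupLikeElem K a}.Finite :=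
    (linearIndepOn_isGroupLikeElem (R := K) (A := A)).linearIndependent.setFinite
  obtain ⟨i, j, hij, e⟩ : ∃ i j : ℕ, i < j ∧ b ^ i = b ^ j := by
    have : ¬ Function.Injective fun k : ℕ => b ^ k := fun hi =>
      Set.infinite_range_of_injective hi (hfin.subset (Set.range_subset_iff.2
        (hA.isGroupLikeElem_antipode_modularElement_pow ht)))
    simp only [Function.Injective, not_forall] at this
    obtain ⟨i, j, e, hne⟩ := this
    rcases lt_or_gt_of_ne hne with h | h
    · exact ⟨i, j, h, e⟩
    · exact ⟨j, i, h, e.symm⟩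
  have hu : IsUnit b := ⟨⟨b, _, hA.antipode_modularElement_mul ht,
    hA.modularElement_mul_antipode ht⟩, rfl⟩
  have hp : b ^ (j - i) = 1 := by
    refine (hu.pow i).mul_left_cancel ?_
    rw [← pow_add, mul_one, e]
    congr 1
    omega
  have hg : (∑ k ∈ Finset.range (j - i), b ^ k) * (b - 1) = 0 := by
    rw [geom_sum_mul, hp, sub_self]
  -- The sum is the nonzero scalar j - i plus a multiple of the nilpotent b - 1, hence a unit; this
  -- is where characteristic zero enters.
  have hgu : IsUnit (∑ k ∈ Finset.range (j - i), b ^ k) := by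
    have hc : IsUnit ((j - i : ℕ) : A) := by
      have : IsUnit ((j - i : ℕ) : K) := by
        rw [isUnit_iff_ne_zero, Nat.cast_ne_zero]
        omega
      simpa using this.map (algebraMap K A)
    have hd : ∑ k ∈ Finset.range (j - i), b ^ k - ((j - i : ℕ) : A) =
        (b - 1) * ∑ k ∈ Finset.range (j - i), ∑ l ∈ Finset.range k, b ^ l := by
      rw [Finset.mul_sum]
      simp_rw [mul_geom_sum]
      simp
    have hcomm : Commute (b - 1) (∑ k ∈ Finset.range (j - i), ∑ l ∈ Finset.range k, b ^ l) :=
      Commute.sum_right _ _ _ fun k _ => Commute.sum_right _ _ _ fun l _ =>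
        (((Commute.refl b).sub_left (Commute.one_left b)).pow_right l)
    have hnil := hcomm.isNilpotent_mul_right hn
    rw [← hd] at hnil
    have := hnil.isUnit_add_left_of_commute hc (Nat.commute_cast _ _)
    simpa using this
  have h1 : b - 1 = 0 := hgu.mul_left_cancel (by rw [hg, mul_zero])
  have := hA.modularElement_mul_antipode ht
  rwa [← hb, sub_eq_zero.1 h1, mul_one] at this

end IsBiFrobenius

end BiFrobenius

end BiFrob

/-! ### Monomials, degree and integrals in a quantum complete intersection -/

namespace QCIData

variable {K : Type*} [Field K] {n : ℕ} (D : QCIData K n)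

/-! #### Structure constants -/

/-- To reach its place, x_i passes exactly the blocks x_k^{v_k} with k < i. The exact scalar, not
just its nonvanishing, is needed to identify h_v. -/
theorem x_mul_mono_eq (i : Fin n) (v : Fin n → ℕ) :
    D.x i * D.mono v = D.coef i v • D.mono (v + Pi.single i 1) := by
  have key : ∀ l : List (Fin n), l.Pairwise (· < ·) → i ∈ l →
      D.x i * (l.map fun j => D.x j ^ v j).prod =
        (l.map fun k => if k < i then D.q k i ^ v k else 1).prod •
          (l.map fun j => D.x j ^ (v + Pi.single i 1 : Fin n → ℕ) j).prod := by
    intro l hl hi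
    induction l with
    | nil => simp at hi
    | cons j l ih =>
      rw [List.pairwise_cons] at hl
      by_cases hij : i = j
      · subst hij
        have h1 : (l.map fun j => D.x j ^ (v + Pi.single i 1 : Fin n → ℕ) j) =
            l.map fun j => D.x j ^ v j := by
          refine List.map_congr_left fun k hk => ?_
          simp [(hl.1 k hk).ne']
        have h2 : (l.map fun k => if k < i then D.q k i ^ v k else 1) = l.map fun _ => 1 :=
          List.map_congr_left fun k hk => if_neg (hl.1 k hk).asymm
        rw [List.map_cons, List.map_cons, List.map_cons, h1, h2]
        simp [pow_succ', mul_assoc]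
      · have hi' := (List.mem_cons.1 hi).resolve_left hij
        rw [List.map_cons, List.map_cons, List.prod_cons, List.prod_cons, ← mul_assoc,
          D.x_mul_pow, smul_mul_assoc, mul_assoc, ih hl.2 hi', mul_smul_comm, smul_smul,
          List.map_cons, List.prod_cons, if_pos (hl.1 i hi')]
        simp [Ne.symm hij]
  have h := key _ (List.pairwise_lt_finRange n) (List.mem_finRange i)
  rwa [← List.ofFn_eq_map (f := fun k => if k < i then D.q k i ^ v k else 1),
    List.prod_ofFn] at h

theorem x_pow_mul_mono_eq (i : Fin n) (m : ℕ) (v : Fin n → ℕ) :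
    D.x i ^ m * D.mono v = D.coef i v ^ m • D.mono (v + Pi.single i m) := by
  induction m with
  | zero => simp
  | succ m ih =>
    have hc : D.coef i (v + Pi.single i m) = D.coef i v := by
      refine Finset.prod_congr rfl fun k _ => ?_
      split_ifs with hk
      · simp [hk.ne]
      · rfl
    rw [pow_succ', mul_assoc, ih, mul_smul_comm, D.x_mul_mono_eq, hc, smul_smul, add_assoc,
      ← Pi.single_add, ← pow_succ]

theorem mono_mul_mono_eq (u v : Fin n → ℕ) :
    D.mono u * D.mono v = D.qbr (fun i => u i) (fun i => v i) • D.mono (u + v) := by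
  have key : ∀ l : List (Fin n), l.Pairwise (· < ·) →
      (l.map fun j => D.x j ^ u j).prod * D.mono v =
        (l.map fun j => D.coef j v ^ u j).prod •
          D.mono (v + (l.map fun j => Pi.single j (u j)).sum) := by
    intro l hl
    induction l with
    | nil => simp
    | cons j l ih =>
      rw [List.pairwise_cons] at hl
      -- The factors already absorbed have indices above `j`, while `coef j` sees only indices below
      -- `j`.
      have hc : D.coef j (v + (l.map fun j => Pi.single j (u j)).sum) = D.coef j v := by
        refine Finset.prod_congr rfl fun k _ => ?_
        split_ifs with hk
        · have hs : ∀ l' : List (Fin n), (∀ b ∈ l', k < b) →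
              ((l'.map fun j => (Pi.single j (u j) : Fin n → ℕ)).sum) k = 0 := by
            intro l' hl'
            induction l' with
            | nil => simp
            | cons b l' ih' =>
              rw [List.map_cons, List.sum_cons, Pi.add_apply,
                ih' fun b hb => hl' b (List.mem_cons_of_mem _ hb),
                Pi.single_eq_of_ne (hl' b List.mem_cons_self).ne]
          rw [Pi.add_apply, hs l fun b hb => hk.trans (hl.1 b hb), add_zero]
        · rfl
      rw [List.map_cons, List.prod_cons, mul_assoc, ih hl.2, mul_smul_comm, D.x_pow_mul_mono_eq,
        smul_smul, hc, List.map_cons, List.prod_cons, List.map_cons, List.sum_cons, add_assoc,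
        mul_comm (D.coef j v ^ u j)]
      congr 3
      abel
  have h := key _ (List.pairwise_lt_finRange n)
  rw [← List.ofFn_eq_map (f := fun j => D.coef j v ^ u j), List.prod_ofFn,
    ← List.ofFn_eq_map (f := fun j => (Pi.single j (u j) : Fin n → ℕ)), List.sum_ofFn,
    Finset.univ_sum_single, add_comm v u] at h
  refine h.trans ?_
  congr 1
  rw [qbr, Finset.prod_comm]
  refine Finset.prod_congr rfl fun j _ => ?_
  rw [coef, ← Finset.prod_pow]
  refine Finset.prod_congr rfl fun k _ => ?_
  split_ifs
  · rw [← pow_mul, ← zpow_natCast]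
    push_cast
    rw [mul_comm]
  · rw [one_pow]

theorem mono_single (i : Fin n) : D.mono (Pi.single i 1) = D.x i := by
  have := D.x_mul_mono_eq i 0
  rw [D.mono_zero, mul_one, zero_add] at this
  rw [this]
  simp [coef]

theorem algHom_ext {B : Type*} [Semiring B] [Algebra K B] {f g : D.Alg →ₐ[K] B}
    (h : ∀ i, f (D.x i) = g (D.x i)) : f = g := by
  have : f.comp D.proj = g.comp D.proj := FreeAlgebra.hom_ext (funext h)
  ext y
  obtain ⟨p, rfl⟩ := RingQuot.mkAlgHom_surjective K D.Rel y
  exact DFunLike.congr_fun this p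

theorem qbr_ne_zero (u v : Fin n → ℤ) : D.qbr u v ≠ 0 := by
  refine Finset.prod_ne_zero_iff.2 fun i _ => Finset.prod_ne_zero_iff.2 fun j _ => ?_
  split_ifs
  · exact zpow_ne_zero _ (D.q_ne_zero i j)
  · exact one_ne_zero

/-! #### The degree filtration -/

theorem dualMono_mono_eq_zero (u : D.V) (v : Fin n → ℕ) (huv : v ≠ D.exps u) :
    D.dualMono u (D.mono v) = 0 := by
  by_cases hv : ∀ i, v i < D.a i
  · have := D.dualMono_mono u (fun i => ⟨v i, hv i⟩)
    refine this.trans (if_neg fun h => huv ?_)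
    rw [← h]
    rfl
  · push Not at hv
    obtain ⟨i, hi⟩ := hv
    rw [D.mono_eq_zero v i hi, map_zero]

/-- The span of the monomials of degree at least `d`. -/
def degreeGE (d : ℕ) : Submodule K D.Alg :=
  Submodule.span K {y | ∃ v : Fin n → ℕ, d ≤ ∑ i, v i ∧ y = D.mono v}

theorem mono_mem_degreeGE {d : ℕ} {v : Fin n → ℕ} (hv : d ≤ ∑ i, v i) :
    D.mono v ∈ D.degreeGE d := Submodule.subset_span ⟨v, hv, rfl⟩

theorem mul_mem_degreeGE {d e : ℕ} {y z : D.Alg} (hy : y ∈ D.degreeGE d)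
    (hz : z ∈ D.degreeGE e) : y * z ∈ D.degreeGE (d + e) := by
  have h := Submodule.mul_mem_mul hy hz
  rw [degreeGE, degreeGE, Submodule.span_mul_span] at h
  refine Submodule.span_le.2 ?_ h
  rintro _ ⟨_, ⟨u, hu, rfl⟩, _, ⟨v, hv, rfl⟩, rfl⟩
  simp only [D.mono_mul_mono_eq]
  refine Submodule.smul_mem _ _ (D.mono_mem_degreeGE ?_)
  simp only [Pi.add_apply, Finset.sum_add_distrib]
  omega

theorem mem_degreeGE_zero (y : D.Alg) : y ∈ D.degreeGE 0 := by
  have : y ∈ (⊤ : Submodule K D.Alg) := trivial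
  rw [← D.span_mono] at this
  refine Submodule.span_mono ?_ this
  rintro _ ⟨v, rfl⟩
  exact ⟨D.exps v, Nat.zero_le _, rfl⟩

theorem pow_mem_degreeGE {y : D.Alg} (hy : y ∈ D.degreeGE 1) (k : ℕ) :
    y ^ k ∈ D.degreeGE k := by
  induction k with
  | zero => exact D.mem_degreeGE_zero _
  | succ k ih => rw [pow_succ]; exact D.mul_mem_degreeGE ih hy

theorem isNilpotent_of_mem_degreeGE {y : D.Alg} (hy : y ∈ D.degreeGE 1) : IsNilpotent y := by
  -- A monomial of degree at least ∑ a_i has some v_i ≥ a_i, so it vanishes.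
  refine ⟨∑ i, D.a i, ?_⟩
  have h := D.pow_mem_degreeGE hy (∑ i, D.a i)
  have hb : D.degreeGE (∑ i, D.a i) = ⊥ := by
    refine Submodule.span_eq_bot.2 ?_
    rintro _ ⟨v, hv, rfl⟩
    have : Nonempty (Fin n) := ⟨⟨0, by have := D.two_le_n; omega⟩⟩
    obtain ⟨i, -, hi⟩ := Finset.exists_le_of_sum_le Finset.univ_nonempty hv
    exact D.mono_eq_zero v i hi
  rw [hb] at h
  exact h

theorem dualMono_eq_zero_of_mem_degreeGE {d : ℕ} {y : D.Alg} (hy : y ∈ D.degreeGE d) (u : D.V)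
    (hu : ∑ i, D.exps u i < d) : D.dualMono u y = 0 := by
  induction hy using Submodule.span_induction with
  | mem y hy =>
    obtain ⟨v, hv, rfl⟩ := hy
    refine D.dualMono_mono_eq_zero u v fun h => ?_
    rw [h] at hv
    omega
  | zero => simp
  | add y z _ _ hy hz => rw [map_add, hy, hz, add_zero]
  | smul c y _ hy => rw [map_smul, hy, smul_zero]

theorem dualMono_eq_zero_of_mem_homogeneous {d : ℕ} {y : D.Alg} (hy : y ∈ D.homogeneous d)
    (u : D.V) (hu : ∑ i, D.exps u i ≠ d) : D.dualMono u y = 0 := by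
  induction hy using Submodule.span_induction with
  | mem y hy =>
    obtain ⟨v, hv, rfl⟩ := hy
    refine D.dualMono_mono_eq_zero u _ fun h => hu ?_
    rw [← h, hv]
  | zero => simp
  | add y z _ _ hy hz => rw [map_add, hy, hz, add_zero]
  | smul c y _ hy => rw [map_smul, hy, smul_zero]

theorem eq_zero_of_dualMono {y : D.Alg} (hy : ∀ u, D.dualMono u y = 0) : y = 0 :=
  D.stdBasis.ext_elem fun u => by rw [map_zero]; exact hy u

/-- Lets congruences modulo higher degree become equalities for homogeneous elements. -/
theorem eq_zero_of_mem_homogeneous_of_mem_degreeGE {d : ℕ} {y : D.Alg}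
    (hy : y ∈ D.homogeneous d) (hy' : y ∈ D.degreeGE (d + 1)) : y = 0 :=
  D.eq_zero_of_dualMono fun u => by
    by_cases hu : ∑ i, D.exps u i = d
    · exact D.dualMono_eq_zero_of_mem_degreeGE hy' u (by omega)
    · exact D.dualMono_eq_zero_of_mem_homogeneous hy u hu

/-- The element of `V` corresponding to `e_i`. -/
def unitV (i : Fin n) : D.V := fun j => ⟨(Pi.single i 1 : Fin n → ℕ) j, by
  have := D.two_le_a j
  by_cases h : j = i
  · subst h; simp; omega
  · simp [h]; omega⟩

theorem exps_unitV (i : Fin n) : D.exps (D.unitV i) = Pi.single i 1 := rfl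

theorem sum_exps_unitV (i : Fin n) : ∑ j, D.exps (D.unitV i) j = 1 := by
  rw [exps_unitV, Finset.sum_pi_single']
  simp

theorem x_mem_homogeneous (i : Fin n) : D.x i ∈ D.homogeneous 1 :=
  Submodule.subset_span ⟨D.unitV i, D.sum_exps_unitV i, by rw [exps_unitV, mono_single]⟩

theorem x_mem_degreeGE (i : Fin n) : D.x i ∈ D.degreeGE 1 := by
  rw [← D.mono_single]
  exact D.mono_mem_degreeGE (D.sum_exps_unitV i).ge

theorem smul_x_mem_degreeGE_two {i : Fin n} {c : K} (h : c • D.x i ∈ D.degreeGE 2) : c = 0 := by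
  have := D.dualMono_eq_zero_of_mem_degreeGE h (D.unitV i) (by rw [sum_exps_unitV]; omega)
  rw [map_smul, ← D.mono_single, ← D.exps_unitV, dualMono_mono] at this
  simpa using this

/-! #### Augmentations -/

theorem augmentation_x (ε : D.Alg →ₐ[K] K) (i : Fin n) : ε (D.x i) = 0 := by
  refine pow_eq_zero_iff (n := D.a i) (by have := D.two_le_a i; omega) |>.1 ?_
  rw [← map_pow, D.x_pow, map_zero]

theorem augmentation_mono (ε : D.Alg →ₐ[K] K) (v : Fin n → ℕ) :
    ε (D.mono v) = if v = 0 then 1 else 0 := by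
  split_ifs with h
  · rw [h, D.mono_zero, map_one]
  · obtain ⟨i, hi⟩ := Function.ne_iff.1 h
    rw [mono, map_list_prod, List.map_map]
    refine List.prod_eq_zero (List.mem_map.2 ⟨i, List.mem_finRange i, ?_⟩)
    rw [Function.comp_apply, map_pow, D.augmentation_x, zero_pow hi]

theorem sub_augmentation_mem_degreeGE (ε : D.Alg →ₐ[K] K) (y : D.Alg) :
    y - algebraMap K D.Alg (ε y) ∈ D.degreeGE 1 := by
  have hy := D.mem_degreeGE_zero y
  induction hy using Submodule.span_induction with
  | mem y hy =>
    obtain ⟨v, -, rfl⟩ := hy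
    rw [D.augmentation_mono]
    split_ifs with h
    · simp [h, D.mono_zero]
    · rw [map_zero, sub_zero]
      obtain ⟨i, hi⟩ := Function.ne_iff.1 h
      refine D.mono_mem_degreeGE (le_trans ?_ (Finset.single_le_sum (fun _ _ => Nat.zero_le _)
        (Finset.mem_univ i)))
      exact Nat.one_le_iff_ne_zero.2 hi
  | zero => simp
  | add y z _ _ hy hz =>
    rw [map_add, map_add, add_sub_add_comm]
    exact Submodule.add_mem _ hy hz
  | smul c y _ hy =>
    have : c • y - algebraMap K D.Alg (ε (c • y)) = c • (y - algebraMap K D.Alg (ε y)) := by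
      rw [map_smul, smul_sub, Algebra.smul_def c (algebraMap K D.Alg (ε y)), ← map_mul,
        smul_eq_mul]
    rw [this]
    exact Submodule.smul_mem _ _ hy

/-- The scalar part ε(z) is central, so only z - ε(z), of degree at least one, contributes. -/
theorem commutator_mem_degreeGE_two (ε : D.Alg →ₐ[K] K) (z : D.Alg) (i : Fin n) :
    z * D.x i - D.x i * z ∈ D.degreeGE 2 := by
  have hz := D.sub_augmentation_mem_degreeGE ε z
  have hx := D.x_mem_degreeGE i
  have : z * D.x i - D.x i * z = (z - algebraMap K D.Alg (ε z)) * D.x i -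
      D.x i * (z - algebraMap K D.Alg (ε z)) := by
    rw [sub_mul, mul_sub, Algebra.commutes (ε z) (D.x i)]
    abel
  have h1 := D.mul_mem_degreeGE hz hx
  have h2 := D.mul_mem_degreeGE hx hz
  rw [one_add_one_eq_two] at h1 h2
  rw [this]
  exact Submodule.sub_mem _ h1 h2

theorem mono_top_mul (ε : D.Alg →ₐ[K] K) (y : D.Alg) :
    D.mono (D.exps D.top) * y = ε y • D.mono (D.exps D.top) := by
  have hy := D.mem_degreeGE_zero y
  induction hy using Submodule.span_induction with
  | mem y hy =>
    obtain ⟨v, -, rfl⟩ := hy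
    rw [D.augmentation_mono]
    split_ifs with h
    · simp [h, D.mono_zero]
    · obtain ⟨i, hi⟩ := Function.ne_iff.1 h
      have hi : v i ≠ 0 := hi
      rw [D.mono_mul_mono_eq, D.mono_eq_zero _ i, smul_zero, zero_smul]
      simp only [Pi.add_apply, exps, top]
      omega
  | zero => simp
  | add y z _ _ hy hz => rw [mul_add, hy, hz, map_add, add_smul]
  | smul c y _ hy => rw [mul_smul_comm, hy, map_smul, smul_smul, smul_eq_mul]

theorem mul_mono_top (ε : D.Alg →ₐ[K] K) (y : D.Alg) :
    y * D.mono (D.exps D.top) = ε y • D.mono (D.exps D.top) := by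
  have hy := D.mem_degreeGE_zero y
  induction hy using Submodule.span_induction with
  | mem y hy =>
    obtain ⟨v, -, rfl⟩ := hy
    rw [D.augmentation_mono]
    split_ifs with h
    · simp [h, D.mono_zero]
    · obtain ⟨i, hi⟩ := Function.ne_iff.1 h
      have hi : v i ≠ 0 := hi
      rw [D.mono_mul_mono_eq, D.mono_eq_zero _ i, smul_zero, zero_smul]
      simp only [Pi.add_apply, exps, top]
      omega
  | zero => simp
  | add y z _ _ hy hz => rw [add_mul, hy, hz, map_add, add_smul]
  | smul c y _ hy => rw [smul_mul_assoc, hy, map_smul, smul_smul, smul_eq_mul]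

theorem dualMono_top_mono_top : D.dualMono D.top (D.mono (D.exps D.top)) = 1 := by
  rw [dualMono_mono, if_pos rfl]

/-- An integral s satisfies x_{a-1}^*(sy) = ε(y) x_{a-1}^*(s), so nondegeneracy determines it by its
top coefficient. -/
theorem rightIntegrals_eq (ε : D.Alg →ₐ[K] K) :
    BiFrob.rightIntegrals ε.toLinearMap = Submodule.span K {D.mono (D.exps D.top)} := by
  refine le_antisymm (fun s hs => Submodule.mem_span_singleton.2 ⟨D.dualMono D.top s, ?_⟩) ?_
  · refine D.isFrobenius_dualMono_top.ext_left fun y => ?_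
    have hs := hs y
    rw [AlgHom.toLinearMap_apply] at hs
    rw [hs, smul_mul_assoc, D.mono_top_mul ε, map_smul, map_smul, map_smul,
      D.dualMono_top_mono_top]
    simp [mul_comm]
  · rw [Submodule.span_singleton_le_iff_mem]
    exact D.mono_top_mul ε

theorem leftIntegrals_eq (ε : D.Alg →ₐ[K] K) :
    BiFrob.leftIntegrals ε.toLinearMap = Submodule.span K {D.mono (D.exps D.top)} := by
  refine le_antisymm (fun s hs => Submodule.mem_span_singleton.2 ⟨D.dualMono D.top s, ?_⟩) ?_
  · refine D.isFrobenius_dualMono_top.ext_right fun y => ?_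
    have hs := hs y
    rw [AlgHom.toLinearMap_apply] at hs
    rw [hs, mul_smul_comm, D.mul_mono_top ε, map_smul, map_smul, map_smul,
      D.dualMono_top_mono_top]
    simp [mul_comm]
  · rw [Submodule.span_singleton_le_iff_mem]
    exact D.mul_mono_top ε

/-! #### The canonical Nakayama automorphism -/

/-- Only the monomial complementary to x_v pairs nontrivially with it, and the two orders of
multiplication differ by h_v. Without a bi-Frobenius structure the eigenvalue is h_v⁻¹; it becomes
h_v once N² = Id is known. -/
theorem canonicalNakayama_mono (v : D.V) : D.canonicalNakayama (D.mono (D.exps v)) =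
    (D.h fun i => (D.exps v i : ℤ))⁻¹ • D.mono (D.exps v) := by
  refine D.isFrobenius_dualMono_top.ext_right fun y => ?_
  rw [canonicalNakayama, ← BiFrob.IsFrobenius.nakayama_spec]
  have hy := D.mem_degreeGE_zero y
  induction hy using Submodule.span_induction with
  | mem y hy =>
    obtain ⟨u, -, rfl⟩ := hy
    rw [mul_smul_comm, D.mono_mul_mono_eq, D.mono_mul_mono_eq, map_smul, map_smul, map_smul,
      add_comm u]
    by_cases huv : D.exps v + u = D.exps D.top
    · have hu : (fun i => (u i : ℤ)) = D.aSubOne - fun i => (D.exps v i : ℤ) := by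
        funext i
        have h1 := congrFun huv i
        have h2 := D.two_le_a i
        simp only [Pi.add_apply, top, exps] at h1
        simp only [Pi.sub_apply, aSubOne, exps]
        omega
      rw [huv, D.dualMono_top_mono_top, hu, h, inv_div]
      simp only [smul_eq_mul, mul_one]
      rw [div_mul_cancel₀ _ (D.qbr_ne_zero _ _)]
    · rw [D.dualMono_mono_eq_zero _ _ huv]
      simp
  | zero => simp
  | add y z _ _ hy hz => rw [mul_add, map_add, hy, hz, add_mul, map_add]
  | smul c y _ hy => rw [mul_smul_comm, map_smul, hy, smul_mul_assoc, map_smul]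

theorem canonicalNakayama_x (i : Fin n) :
    D.canonicalNakayama (D.x i) = (D.h (Pi.single i 1))⁻¹ • D.x i := by
  have := D.canonicalNakayama_mono (D.unitV i)
  rw [exps_unitV, mono_single] at this
  convert this using 4
  funext j
  by_cases hj : j = i
  · subst hj; simp
  · simp [hj]

end QCIData

/-! ### Comparing Frobenius homomorphisms and conjugation by units -/

namespace QCIData

variable {K : Type*} [Field K] {n : ℕ} (D : QCIData K n)

instance : IsNoetherianRing D.Alg :=
  isNoetherian_of_tower K (inferInstance : IsNoetherian K D.Alg)

/-- Every Frobenius homomorphism is a unit translate of `x_{a-1}^*`. -/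
theorem exists_eq_rightAct {φ : Module.Dual K D.Alg} (hφ : BiFrob.IsFrobenius φ) :
    ∃ z : D.Algˣ, φ = BiFrob.rightAct (D.dualMono D.top) (z : D.Alg) := by
  obtain ⟨a, ha⟩ := D.isFrobenius_dualMono_top φ
  obtain ⟨b, hb⟩ := hφ (D.dualMono D.top)
  have hspec := D.isFrobenius_dualMono_top.nakayama_spec
  change ∀ x y, D.dualMono D.top (x * y) = D.dualMono D.top (y * D.canonicalNakayama x) at hspec
  -- The inverse Nakayama automorphism moves the factor `a` from the right of the argument to the
  -- left.
  set z := D.canonicalNakayama.symm a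
  have hz : φ = BiFrob.rightAct (D.dualMono D.top) z := by
    ext y
    rw [ha]
    change D.dualMono D.top (y * a) = D.dualMono D.top (z * y)
    rw [hspec z, AlgEquiv.apply_symm_apply]
  have hbz : b * D.canonicalNakayama z = 1 := D.isFrobenius_dualMono_top.ext_right fun y => by
    have := LinearMap.congr_fun hb y
    rw [hz] at this
    change _ = D.dualMono D.top (z * (y * b)) at this
    rw [mul_one, this, hspec z, mul_assoc]
  have hinv : D.canonicalNakayama.symm b * z = 1 := D.canonicalNakayama.injective (by
    rw [map_mul, AlgEquiv.apply_symm_apply, hbz, map_one])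
  exact ⟨⟨z, _, mul_eq_one_comm.1 hinv, hinv⟩, hz⟩

theorem rightAct_mono_top (ε : D.Alg →ₐ[K] K) (z : D.Alg) :
    BiFrob.rightAct (D.dualMono D.top) z (D.mono (D.exps D.top)) = ε z := by
  change D.dualMono D.top (z * D.mono (D.exps D.top)) = _
  rw [D.mul_mono_top ε, map_smul, D.dualMono_top_mono_top, smul_eq_mul, mul_one]

/-- With ψ = x_{a-1}^*, expand φ(xy) = ψ(zxy) in two ways: as ψ(y N(zx)), and as φ(y N_φ(x)) = ψ(zy
N_φ(x)) = ψ(y N_φ(x) N(z)). -/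
theorem nakayama_mul_canonicalNakayama {φ : Module.Dual K D.Alg} (hφ : BiFrob.IsFrobenius φ)
    {z : D.Alg} (hz : φ = BiFrob.rightAct (D.dualMono D.top) z) (x : D.Alg) :
    hφ.nakayama x * D.canonicalNakayama z = D.canonicalNakayama z * D.canonicalNakayama x := by
  refine D.isFrobenius_dualMono_top.ext_right fun y => ?_
  have hspec := D.isFrobenius_dualMono_top.nakayama_spec
  change ∀ x y, D.dualMono D.top (x * y) = D.dualMono D.top (y * D.canonicalNakayama x) at hspec
  have hφz : ∀ y, φ y = D.dualMono D.top (z * y) := fun y => by rw [hz]; rfl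
  rw [← mul_assoc y, ← hspec, ← hφz, ← hφ.nakayama_spec, hφz, ← mul_assoc, hspec (z * x),
    map_mul D.canonicalNakayama]

/-- Conjugation by a unit acts trivially on generators modulo terms of degree at least two. -/
theorem sub_mem_degreeGE_two (ε : D.Alg →ₐ[K] K) {u y : D.Alg} (hu : IsUnit u) {i : Fin n} {c : K}
    (h : y * u = u * c • D.x i) : y - c • D.x i ∈ D.degreeGE 2 := by
  obtain ⟨u, rfl⟩ := hu
  have hm := D.mul_mem_degreeGE (Submodule.smul_mem _ c (D.commutator_mem_degreeGE_two ε u i))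
    (D.mem_degreeGE_zero (↑u⁻¹ : D.Alg))
  rw [add_zero] at hm
  have e : y = u * c • D.x i * ↑u⁻¹ := by rw [← h, mul_assoc, Units.mul_inv, mul_one]
  have : y - c • D.x i = c • (↑u * D.x i - D.x i * ↑u) * ↑u⁻¹ := by
    rw [e, smul_sub, sub_mul, mul_smul_comm, smul_mul_assoc c (D.x i * ↑u), mul_assoc (D.x i),
      Units.mul_inv, mul_one]
  rw [this]
  exact hm

theorem mono_exps_ne_zero (v : D.V) : D.mono (D.exps v) ≠ 0 := by
  rw [← D.stdBasis_apply]
  exact D.stdBasis.ne_zero v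

theorem canonicalNakayama_mem_homogeneous {d : ℕ} {y : D.Alg} (hy : y ∈ D.homogeneous d) :
    D.canonicalNakayama y ∈ D.homogeneous d := by
  induction hy using Submodule.span_induction with
  | mem y hy =>
    obtain ⟨v, hv, rfl⟩ := hy
    rw [D.canonicalNakayama_mono]
    exact Submodule.smul_mem _ _ (Submodule.subset_span ⟨v, hv, rfl⟩)
  | zero => rw [map_zero]; exact Submodule.zero_mem _
  | add y z _ _ hy hz => rw [map_add]; exact Submodule.add_mem _ hy hz
  | smul c y _ hy => rw [map_smul]; exact Submodule.smul_mem _ _ hy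

/-! ### Bi-Frobenius structures on a quantum complete intersection -/

section BiFrobenius

variable [Coalgebra K D.Alg] {φ : Module.Dual K D.Alg} {t : D.Alg} {S : D.Alg →ₗ[K] D.Alg}

theorem rightIntegrals_counit (hA : BiFrob.IsBiFrobenius φ t S) :
    BiFrob.rightIntegrals (Coalgebra.counit (R := K) (A := D.Alg)) =
      Submodule.span K {D.mono (D.exps D.top)} := D.rightIntegrals_eq hA.counitHom

theorem leftIntegrals_counit (hA : BiFrob.IsBiFrobenius φ t S) :
    BiFrob.leftIntegrals (Coalgebra.counit (R := K) (A := D.Alg)) =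
      Submodule.span K {D.mono (D.exps D.top)} := D.leftIntegrals_eq hA.counitHom

theorem integral_mem_leftIntegrals (hA : BiFrob.IsBiFrobenius φ t S) :
    t ∈ BiFrob.leftIntegrals (Coalgebra.counit (R := K) (A := D.Alg)) := by
  rw [D.leftIntegrals_counit hA, ← D.rightIntegrals_counit hA]
  exact hA.mem_rightIntegrals

theorem antipode_antipode_nakayama (hA : BiFrob.IsBiFrobenius φ t S) (x : D.Alg) :
    S (S (hA.frobenius.nakayama x)) = x :=
  hA.frobenius.nakayama.injective
    (hA.nakayama_antipode_antipode (D.integral_mem_leftIntegrals hA) _)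

/-- N_φ²(x_i) is computed twice modulo degree two: from N, with factor h_{e_i}⁻², and from S⁻⁴, with
factor 1. -/
theorem h_single_sq (hA : BiFrob.IsBiFrobenius φ t S) (i : Fin n) :
    D.h (Pi.single i 1) ^ 2 = 1 := by
  have ht := D.integral_mem_leftIntegrals hA
  obtain ⟨z, hz⟩ := D.exists_eq_rightAct hA.frobenius
  set ν := hA.frobenius.nakayama
  set c := (D.h (Pi.single i 1))⁻¹
  have hν : ∀ x, ν x * D.canonicalNakayama z = D.canonicalNakayama z * D.canonicalNakayama x :=
    D.nakayama_mul_canonicalNakayama hA.frobenius hz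
  have hzu : IsUnit (D.canonicalNakayama z) := z.isUnit.map D.canonicalNakayama
  -- Iterating N_φ = Ad(N(z)) ∘ N makes N_φ² equal to N² followed by conjugation by N_φ(N(z)) N(z).
  have h1 : ν (ν (D.x i)) - (c * c) • D.x i ∈ D.degreeGE 2 := by
    refine D.sub_mem_degreeGE_two hA.counitHom
      (u := ν (D.canonicalNakayama z) * D.canonicalNakayama z) ((hzu.map ν).mul hzu) ?_
    rw [← mul_assoc, ← map_mul ν, hν (D.x i), map_mul ν, mul_assoc, hν (D.canonicalNakayama (D.x i)),
      ← mul_assoc, D.canonicalNakayama_x, map_smul, D.canonicalNakayama_x, smul_smul]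
  -- N_φ² = S⁻⁴ is conjugation by S(𝔞) = 𝔞⁻¹.
  have h2 : ν (ν (D.x i)) - (1 : K) • D.x i ∈ D.degreeGE 2 := by
    have hu : IsUnit (S (BiFrob.modularElement φ t)) :=
      ⟨⟨_, _, hA.antipode_modularElement_mul ht, hA.modularElement_mul_antipode ht⟩, rfl⟩
    refine D.sub_mem_degreeGE_two hA.counitHom hu ?_
    have h := hA.modularElement_mul ht (ν (ν (D.x i)))
    rw [D.antipode_antipode_nakayama hA, D.antipode_antipode_nakayama hA] at h
    have h' := congrArg (fun y => S (BiFrob.modularElement φ t) * y *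
      S (BiFrob.modularElement φ t)) h
    simp only [← mul_assoc, hA.antipode_modularElement_mul ht, one_mul] at h'
    rw [h', mul_assoc, mul_assoc, hA.modularElement_mul_antipode ht, mul_one, one_smul]
  have h3 := Submodule.sub_mem _ h2 h1
  rw [sub_sub_sub_cancel_left, ← sub_smul] at h3
  have h4 := D.smul_x_mem_degreeGE_two h3
  rw [sub_eq_zero, ← pow_two, inv_pow, inv_eq_one] at h4
  exact h4

theorem canonicalNakayama_canonicalNakayama (hA : BiFrob.IsBiFrobenius φ t S) (y : D.Alg) :
    D.canonicalNakayama (D.canonicalNakayama y) = y := by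
  have : D.canonicalNakayama.toAlgHom.comp D.canonicalNakayama.toAlgHom = AlgHom.id K D.Alg :=
    D.algHom_ext fun i => by
      change D.canonicalNakayama (D.canonicalNakayama (D.x i)) = D.x i
      rw [D.canonicalNakayama_x, map_smul, D.canonicalNakayama_x, smul_smul, ← pow_two, inv_pow,
        D.h_single_sq hA, inv_one, one_smul]
  exact DFunLike.congr_fun this y

theorem canonicalNakayama_mono_eq_smul (hA : BiFrob.IsBiFrobenius φ t S) (v : D.V) :
    D.canonicalNakayama (D.mono (D.exps v)) =
      D.h (fun i => (D.exps v i : ℤ)) • D.mono (D.exps v) := by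
  have h1 := D.canonicalNakayama_canonicalNakayama hA (D.mono (D.exps v))
  rw [D.canonicalNakayama_mono, map_smul, D.canonicalNakayama_mono, smul_smul] at h1
  have h2 := smul_left_injective K (D.mono_exps_ne_zero v) (h1.trans (one_smul K _).symm)
  rw [D.canonicalNakayama_mono]
  congr 1
  have h3 := inv_eq_of_mul_eq_one_left h2
  rw [inv_inv] at h3
  exact h3.symm

/-- N_φ ∘ S² = Id, so N ∘ S² is inner and fixes x_i modulo degree two. Both N and S² preserve degree
one, so x_i is fixed exactly, and N² = Id gives the claim. -/
theorem antipode_antipode_eq_of_isGradedMap (hA : BiFrob.IsBiFrobenius φ t S)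
    (hS : D.IsGradedMap S) (y : D.Alg) : S (S y) = D.canonicalNakayama y := by
  have ht := D.integral_mem_leftIntegrals hA
  obtain ⟨z, hz⟩ := D.exists_eq_rightAct hA.frobenius
  let T : D.Alg →ₐ[K] D.Alg := AlgHom.ofLinearMap (S ∘ₗ S) (by simp [hA.antipode_one])
    fun x y => by simp [hA.antipode_mul]
  have hT : D.canonicalNakayama.toAlgHom.comp T = AlgHom.id K D.Alg := D.algHom_ext fun i => by
    change D.canonicalNakayama (S (S (D.x i))) = D.x i
    have hx := D.x_mem_homogeneous i
    refine sub_eq_zero.1 (D.eq_zero_of_mem_homogeneous_of_mem_degreeGE (d := 1)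
      (Submodule.sub_mem _ (D.canonicalNakayama_mem_homogeneous (hS _ _ (hS _ _ hx))) hx) ?_)
    have hν := D.nakayama_mul_canonicalNakayama hA.frobenius hz (S (S (D.x i)))
    rw [hA.nakayama_antipode_antipode ht] at hν
    set u : D.Algˣ := Units.map (D.canonicalNakayama : D.Alg →* D.Alg) z
    have hu : (u : D.Alg) = D.canonicalNakayama z := rfl
    rw [← hu] at hν
    have h := D.sub_mem_degreeGE_two hA.counitHom (u⁻¹).isUnit (i := i) (c := 1)
      (y := D.canonicalNakayama (S (S (D.x i)))) (by
        rw [one_smul, Units.eq_inv_mul_iff_mul_eq, ← mul_assoc, ← hν, mul_assoc, Units.mul_inv,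
          mul_one])
    rwa [one_smul] at h
  rw [← D.canonicalNakayama_canonicalNakayama hA (S (S y))]
  exact congrArg _ (DFunLike.congr_fun hT y)

/-- ε(S(𝔞)) = ε(𝔞) = 1 puts S(𝔞) - 1 in the augmentation ideal, whose elements are nilpotent. -/
theorem modularElement_eq_one [CharZero K] (hA : BiFrob.IsBiFrobenius φ t S) :
    BiFrob.modularElement φ t = 1 := by
  refine hA.modularElement_eq_one (D.integral_mem_leftIntegrals hA)
    (D.isNilpotent_of_mem_degreeGE ?_)
  have h := D.sub_augmentation_mem_degreeGE hA.counitHom (S (BiFrob.modularElement φ t))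
  rwa [hA.counitHom_apply, hA.counit_antipode, hA.counit_modularElement, map_one] at h

theorem antipode_pow_four [CharZero K] (hA : BiFrob.IsBiFrobenius φ t S) (y : D.Alg) :
    S (S (S (S y))) = y := by
  have h := hA.modularElement_mul (D.integral_mem_leftIntegrals hA) y
  rw [D.modularElement_eq_one hA, one_mul, mul_one] at h
  exact h.symm

end BiFrobenius

end QCIData

end

theorem proposition4p1 {K : Type*} [Field K] {n : ℕ} (D : QCIData K n) [Coalgebra K D.Alg]
    (φ : Module.Dual K D.Alg) (t : D.Alg) (S : D.Alg →ₗ[K] D.Alg)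
    (hA : BiFrob.IsBiFrobenius φ t S) :
    -- the Frobenius homomorphism
    ((∃ z : D.Algˣ, φ = BiFrob.rightAct (D.dualMono D.top) (z : D.Alg)) ∧
      ∃ c : D.V → K, φ = ∑ v, c v • D.dualMono v ∧ c D.top ≠ 0) ∧
    -- the right modular function and the counit
    (BiFrob.modularFunction φ t = Coalgebra.counit ∧
      ∀ v : D.V, Coalgebra.counit (R := K) (D.mono (D.exps v)) =
        if D.exps v = 0 then 1 else 0) ∧
    -- the integral `t`
    ((∃ c : K, c ≠ 0 ∧ t = c • D.mono (D.exps D.top)) ∧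
      BiFrob.IsUnimodular (Coalgebra.counit (R := K) (A := D.Alg)) ∧
      BiFrob.rightIntegrals (Coalgebra.counit (R := K) (A := D.Alg)) =
        Submodule.span K {D.mono (D.exps D.top)}) ∧
    -- the canonical Nakayama automorphism
    ((∀ y, D.canonicalNakayama (D.canonicalNakayama y) = y) ∧
      (∀ i, D.h (Pi.single i 1) ^ 2 = 1) ∧
      ∀ v : D.V, D.canonicalNakayama (D.mono (D.exps v)) =
        D.h (fun i => (D.exps v i : ℤ)) • D.mono (D.exps v)) ∧
    -- graded antipodes
    (D.IsGradedMap S →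
      (∀ y, S (S y) = D.canonicalNakayama y) ∧ ∀ y, S (S (S (S y))) = y) ∧
    -- characteristic zero
    (CharZero K →
      BiFrob.modularElement φ t = 1 ∧
      (∀ y, hA.frobenius.nakayama (hA.frobenius.nakayama y) = y) ∧
      ∀ y, S (S (S (S y))) = y) := by
  have ht := D.integral_mem_leftIntegrals hA
  refine ⟨⟨D.exists_eq_rightAct hA.frobenius, fun v => φ (D.stdBasis v),
      (D.stdBasis.sum_dual_apply_smul_coord φ).symm, ?_⟩, ⟨?_, fun v => ?_⟩,
    ⟨?_, (D.rightIntegrals_counit hA).trans (D.leftIntegrals_counit hA).symm,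
      D.rightIntegrals_counit hA⟩,
    ⟨D.canonicalNakayama_canonicalNakayama hA, D.h_single_sq hA,
      D.canonicalNakayama_mono_eq_smul hA⟩, fun hS => ?_, fun _ => ?_⟩
  · obtain ⟨z, hz⟩ := D.exists_eq_rightAct hA.frobenius
    change φ (D.stdBasis D.top) ≠ 0
    rw [D.stdBasis_apply, hz, D.rightAct_mono_top hA.counitHom]
    exact (z.isUnit.map hA.counitHom).ne_zero
  · ext x
    change φ (x * t) = _
    rw [ht, map_smul, hA.apply_integral, smul_eq_mul, mul_one]
  · exact D.augmentation_mono hA.counitHom _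
  · have h := hA.mem_rightIntegrals
    rw [D.rightIntegrals_counit hA] at h
    obtain ⟨c, hc⟩ := Submodule.mem_span_singleton.1 h
    refine ⟨c, ?_, hc.symm⟩
    rintro rfl
    have := hA.apply_integral
    rw [← hc, zero_smul, map_zero] at this
    exact zero_ne_one this
  · have h := D.antipode_antipode_eq_of_isGradedMap hA hS
    exact ⟨h, fun y => by rw [h, h, D.canonicalNakayama_canonicalNakayama hA]⟩
  · refine ⟨D.modularElement_eq_one hA, fun y => ?_, D.antipode_pow_four hA⟩
    -- N_φ² = S⁻⁴, so inserting S⁴ = Id cancels both Nakayama maps.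
    rw [← D.antipode_pow_four hA (hA.frobenius.nakayama (hA.frobenius.nakayama y)),
      D.antipode_antipode_nakayama hA, D.antipode_antipode_nakayama hA]
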